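/- **Setting.** Let $G:\mathbb R^{d_x}\to\mathbb R$ be differentiable, $\mu_x$-strongly convex ($\mu_x>0$: $G(x')-G(x'')-\langle\nabla G(x''),x'-x''\rangle\ge\frac{\mu_x}{2}\|x'-x''\|^2$) and $L_x$-smooth ($\nabla G$ is $L_x$-Lipschitz); let $F:\mathbb R^{d_y}\to\mathbb R\cup\{+\infty\}$ be proper, closed and convex with conjugate $F^\star$; let $K:\mathbb R^{d_x}\to\mathbb R^{d_y}$ be linear, $K\ne0$, $L_{xy}=\|K\|=\max_{\|x\|=1}\|Kx\|$; and let $\mu_{xy}>0$ satisfy $\mu_{xy}^2\le\lambda_{\min}^+(KK^\top)$ (the smallest positive eigenvalue) if $\partial F^\star(y)\subseteq\operatorname{range}K$ for all $y$, and $\mu_{xy}^2\le\lambda_{\min}(KK^\top)$ otherwise. Assume that $$\min_x\max_y\ \{G(x)+\langle y,Kx\rangle-F^\star(y)\}$$ has a solution (saddle point). Write $\kappa_x=L_x/\mu_x$ and $\kappa_{xy}=L_{xy}/\mu_{xy}$. **Inner method.** A gradient method $\mathcal M$ is a deterministic procedure which, given a smoothness constant $L$, a number of iterations $T$ and a starting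 point $w^0$, makes at most $T$ gradient evaluations and returns a point $w^T$. It has rate $(A,\alpha)$ if, for every $L>0$, every convex $L$-smooth $\Psi$ on $\mathbb R^{d_x}$ with a minimizer $w^\star$, every $w^0$ and every $T\ge1$, $\|\nabla\Psi(w^T)\|^2\le A L^2\|w^0-w^\star\|^2/T^\alpha$. **Algorithm (APDA with inexact prox).** From $(x^0,y^0)$, with $\bar y^0=y^0$, for $k=0,1,\dots$: let $\Psi^k(x)=G(x)+\frac1{2\eta_x}\|x-(x^k-\eta_xK^\top\bar y^k)\|^2$, let $w^{\star k}$ be its minimizer, and let $\hat x^k$ be the output of $T$ iterations of $\mathcal M$ on $\Psi^k$ started at $x^k$ with $L=L_x+1/\eta_x$; then $$x^{k+1}=x^k-\eta_x(\nabla G(\hat x^k)+K^\top\bar y^k),$$ $$y^{k+1}\in y^k-\eta_y(\partial F^\star(y^{k+1})-K\hat x^k)-\eta_y\beta_yK(K^\top y^k+\nabla G(\hat x^k)),$$ $$\bar y^{k+1}=y^{k+1}+\theta(y^{k+1}-y^k).$$ Each outer iteration uses one evaluation of the prox of $F^\star$, and the evaluations of $\nabla G$ made by $\mathcal M$ plus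 one (at $\hat x^k$). **Parameters.** $$\eta_x=\frac1{4\sqrt{L_x\mu_x}}\frac{\mu_{xy}}{L_{xy}},\quad \eta_y=\frac{\sqrt{L_x\mu_x}}{8L_{xy}\mu_{xy}},\quad \beta_y=\min\Big\{\frac1{L_x},\frac1{2L_{xy}^2\eta_y}\Big\},\quad \theta=\max\Big\{\frac2{2+\mu_x\eta_x},\,1-\mu_{xy}^2\beta_y\eta_y\Big\},$$ $$T_{A,\alpha}=(20A)^{1/\alpha}\big(1+\sqrt{L_x/\mu_x}\big)^{2/\alpha}.$$ **Theorem.** For any $\eta_x,\eta_y>0$ (and any $\theta$, $\beta_y$, $T$, $\mathcal M$, $x^0$, $y^0$) the algorithm is well defined. For every $y^0$ there is exactly one solution $(x^\star,y^\star)$ with $y^\star-y^0\in\operatorname{range}K$; fix it, and set $$\Delta^0=\Big(1+\tfrac{\mu_x\eta_x}2\Big)\tfrac1{\eta_x}\|x^0-x^\star\|^2+\tfrac1{\eta_y}\|y^0-y^\star\|^2,$$ $$\Delta^{k+1}=\Big(1+\tfrac{\mu_x\eta_x}2\Big)\tfrac1{\eta_x}\|x^{k+1}-x^\star\|^2+\tfrac1{\eta_y}\|y^{k+1}-y^\star\|^2+\tfrac1{2\eta_y}\|y^{k+1}-y^k\|^2+\tfrac1{8\eta_x}\|x^k-w^{\star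 k}\|^2-2\langle K^\top y^{k+1}-K^\top y^k,\hat x^k-x^\star\rangle .$$ 1. *(Linear convergence.)* If $\mathcal M$ has rate $(A,\alpha)$ with $A>0$, $\alpha\ge2$, and $T$ is an integer with $T\ge T_{A,\alpha}$, then $0<\theta<1$ and for all $k\ge0$: $\Delta^{k+1}\le\theta\Delta^k$, $\Delta^k\le\theta^k\Delta^0$, and both $\frac1{2\eta_x}\|x^k-x^\star\|^2+\frac1{\eta_y}\|y^k-y^\star\|^2$ and $\frac1{2\eta_x}\|x^{k+1}-x^\star\|^2+\frac1{\eta_y}\|y^{k+1}-y^\star\|^2$ are at most $\Delta^k$. 2. *(Complexity.)* There is an absolute constant $C>0$ such that, for $\mathcal M$ of rate $(A,\alpha)$ with $A>0$, $\alpha\ge2$, for $T=\lceil T_{A,\alpha}\rceil$ and for every $0<\varepsilon\le\frac12$, some $N$ that does not depend on $(x^0,y^0)$ satisfies $\Delta^k\le\varepsilon\Delta^0$ for all $k\ge N$, and the first $N$ iterations use at most $$C\max\{\sqrt{\kappa_x}\,\kappa_{xy},\kappa_{xy}^2\}\log\tfrac1\varepsilon\ \text{ evaluations of the prox of }F^\star,$$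 $$C\max\{1,A\}^{1/\alpha}\max\Big\{\kappa_x^{\frac{2+\alpha}{2\alpha}}\kappa_{xy},\ \kappa_x^{1/\alpha}\kappa_{xy}^2\Big\}\log\tfrac1\varepsilon\ \text{ evaluations of }\nabla G.$$ 3. *(Concrete inner methods.)* With the same number of prox evaluations of $F^\star$ (up to the absolute constant), and an absolute constant $C$, the number of evaluations of $\nabla G$ is at most: (i) $C\max\{\kappa_x\kappa_{xy},\sqrt{\kappa_x}\,\kappa_{xy}^2\}\log\frac1\varepsilon$ if $\mathcal M$ is gradient descent (GD) with stepsize $1/L$ and $T=\lceil T_{4,2}\rceil$; (ii) $C\max\{\kappa_x^{5/6}\kappa_{xy},\kappa_x^{1/3}\kappa_{xy}^2\}\log\frac1\varepsilon$ if $\mathcal M$ runs Nesterov's fast gradient descent (FGD) for the first half ($\lfloor T/2\rfloor$) of the iterations and GD for the rest, and $T=\lceil T_{64,3}\rceil$; (iii) $C\max\{\kappa_x^{3/4}\kappa_{xy},\kappa_x^{1/4}\kappa_{xy}^2\}\log\frac1\varepsilon$ if $\mathcal M$ runs FGD for the first half and the Kim--Fessler fixed-step first-order method (FSFOM, i.e.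 OGM-G) for the rest, and $T=\lceil T_{256,4}\rceil$. -/

import Mathlib

open scoped InnerProductSpace Gradient

noncomputable section

/-! ### First-order (gradient) methods and the number of gradients they evaluate -/

/-- A deterministic program with access to a gradient oracle: it either stops and returns a point, or
asks for the gradient at a point `p` and continues in a way that may depend on the answer. -/
inductive GradientProgram (E : Type*) where
  | ret (w : E) : GradientProgram E
  | query (p : E) (next : E → GradientProgram E) : GradientProgram E

namespace GradientProgram

variable {E : Type*}

/-- The point returned when the oracle is `g`. -/
def eval (g : E → E) : GradientProgram E → E
  | ret w => w
  | query p next => eval g (next (g p))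

/-- The number of oracle calls made when the oracle is `g`. -/
def cost (g : E → E) : GradientProgram E → ℕ
  | ret _ => 0
  | query p next => cost g (next (g p)) + 1

/-- Run a program and start a second one from the point that the first one returns. -/
def andThen : GradientProgram E → (E → GradientProgram E) → GradientProgram E
  | ret w, f => f w
  | query p next, f => query p (fun v => andThen (next v) f)

end GradientProgram

/-- An iterative gradient method: given the smoothness constant `L`, the number of iterations `T` and
a starting point, it is a program calling the gradient oracle. -/
abbrev GradientMethod (E : Type*) := ℝ → ℕ → E → GradientProgram E

section Methods

variable {E : Type*} [NormedAddCommGroup E] [InnerProductSpace ℝ E]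

/-- `f` is differentiable and its gradient is `L`-Lipschitz. -/
def IsSmoothWith [CompleteSpace E] (L : ℝ) (f : E → ℝ) : Prop :=
  Differentiable ℝ f ∧ ∀ u v : E, ‖∇ f u - ∇ f v‖ ≤ L * ‖u - v‖

/-- `M` makes at most `T` gradient evaluations in `T` iterations, and
`‖∇Ψ(w^T)‖² ≤ A L² ‖w⁰ - w⋆‖² / T ^ α` for every convex `L`-smooth function `Ψ`, every minimizer `w⋆`
of `Ψ`, every starting point `w⁰` and every `T ≥ 1`. -/
def HasGradientRate [CompleteSpace E] (M : GradientMethod E) (A α : ℝ) : Prop :=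
  (∀ (L : ℝ) (T : ℕ) (w₀ : E) (g : E → E), (M L T w₀).cost g ≤ T) ∧
  ∀ (L : ℝ) (Ψ : E → ℝ), 0 < L → ConvexOn ℝ Set.univ Ψ → IsSmoothWith L Ψ →
    ∀ wstar : E, IsMinOn Ψ Set.univ wstar →
      ∀ (w₀ : E) (T : ℕ), 1 ≤ T →
        ‖∇ Ψ ((M L T w₀).eval (∇ Ψ))‖ ^ 2 ≤ A * L ^ 2 * ‖w₀ - wstar‖ ^ 2 / (T : ℝ) ^ α

/-- `n` steps of gradient descent with stepsize `1 / L`. -/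
def gdLoop (L : ℝ) : ℕ → E → GradientProgram E
  | 0, w => .ret w
  | n + 1, w => .query w fun v => gdLoop L n (w - (1 / L) • v)

/-- Gradient descent (GD). -/
def gd : GradientMethod E := fun L T w => gdLoop L T w

/-- `n` steps of Nesterov's fast gradient method from the state `(x, z, t)`:
`x⁺ = z - ∇f(z) / L`, `t⁺ = (1 + √(1 + 4 t²)) / 2`, `z⁺ = x⁺ + ((t - 1) / t⁺) (x⁺ - x)`. -/
def fgdLoop (L : ℝ) : ℕ → E → E → ℝ → GradientProgram E
  | 0, x, _, _ => .ret x
  | n + 1, x, z, t => .query z fun v =>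
      let x' := z - (1 / L) • v
      let t' := (1 + √(1 + 4 * t ^ 2)) / 2
      fgdLoop L n x' (x' + ((t - 1) / t') • (x' - x)) t'

/-- Nesterov's fast gradient descent (FGD). -/
def fgd : GradientMethod E := fun L T w => fgdLoop L T w w 1

/-- `1, (1 + √(1 + 4 · 1²)) / 2, …`: the sequence `θ_N, θ_{N-1}, …, θ_1` of the method below. -/
def fsfomBase : ℕ → ℝ
  | 0 => 1
  | j + 1 => (1 + √(1 + 4 * (fsfomBase j) ^ 2)) / 2

/-- The coefficient `θ_{N-j}` of the `N`-step method: `θ_N = 1`,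
`θ_i = (1 + √(1 + 4 θ_{i+1}²)) / 2` for `1 ≤ i < N`, and `θ_0 = (1 + √(1 + 8 θ_1²)) / 2`. -/
def fsfomTheta (N j : ℕ) : ℝ :=
  if j = N then (1 + √(1 + 8 * (fsfomBase (N - 1)) ^ 2)) / 2 else fsfomBase j

/-- The last `n` of the `N` steps of the Kim--Fessler method, from the state `(x_i, y_i)` with
`i = N - n`: `y_{i+1} = x_i - ∇f(x_i) / L` and
`x_{i+1} = y_{i+1} + ((θ_i - 1)(2 θ_{i+1} - 1) / (θ_i (2 θ_i - 1))) (y_{i+1} - y_i)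
  + ((2 θ_{i+1} - 1) / (2 θ_i - 1)) (y_{i+1} - x_i)`. -/
def fsfomLoop (L : ℝ) (N : ℕ) : ℕ → E → E → GradientProgram E
  | 0, x, _ => .ret x
  | n + 1, x, y => .query x fun v =>
      let a := fsfomTheta N (n + 1)
      let b := fsfomTheta N n
      let y' := x - (1 / L) • v
      fsfomLoop L N n
        (y' + ((a - 1) * (2 * b - 1) / (a * (2 * a - 1))) • (y' - y)
          + ((2 * b - 1) / (2 * a - 1)) • (y' - x)) y'

/-- The fixed-step first-order method of Kim and Fessler for decreasing the gradient (OGM-G). -/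
def fsfom : GradientMethod E := fun L T w => fsfomLoop L T T w w

/-- The first half of the iterations is done by `M₁` and the second half by `M₂`, which is started
at the output of `M₁`. -/
def halfHalf (M₁ M₂ : GradientMethod E) : GradientMethod E := fun L T w =>
  (M₁ L (T / 2) w).andThen (M₂ L (T - T / 2))

end Methods

/-! ### Extended-valued convex functions -/

section Convex

variable {E : Type*} [NormedAddCommGroup E] [InnerProductSpace ℝ E]

/-- Proper, closed (lower semicontinuous) and convex (convex epigraph). -/
structure IsProperClosedConvex (F : E → EReal) : Prop where
  ne_bot : ∀ y, F y ≠ ⊥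
  exists_ne_top : ∃ y, F y ≠ ⊤
  closed : LowerSemicontinuous F
  convex : Convex ℝ {p : E × ℝ | F p.1 ≤ (p.2 : EReal)}

/-- The convex conjugate `F⋆(y) = sup_{y'} (⟨y, y'⟩ - F(y'))`. -/
def conjugate (F : E → EReal) (y : E) : EReal :=
  ⨆ y' : E, ((⟪y, y'⟫_ℝ : ℝ) : EReal) - F y'

/-- The subdifferential of an extended-valued function. -/
def subdifferential (f : E → EReal) (y : E) : Set E :=
  {g | ∀ z : E, f y + ((⟪g, z - y⟫_ℝ : ℝ) : EReal) ≤ f z}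

/-- The smallest eigenvalue of a (symmetric) operator on a finite-dimensional space. -/
def lambdaMin (S : E →L[ℝ] E) : ℝ :=
  sInf {l : ℝ | Module.End.HasEigenvalue (S : Module.End ℝ E) l}

/-- The smallest positive eigenvalue of a (symmetric) operator on a finite-dimensional space. -/
def lambdaMinPos (S : E →L[ℝ] E) : ℝ :=
  sInf {l : ℝ | 0 < l ∧ Module.End.HasEigenvalue (S : Module.End ℝ E) l}

end Convex

/-! ### The saddle-point problem -/

/-- The data of `min_x max_y G(x) + ⟨y, K x⟩ - F⋆(y)` with the constants of its assumptions. -/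
structure SaddleProblem (dx dy : ℕ) where
  G : EuclideanSpace ℝ (Fin dx) → ℝ
  F : EuclideanSpace ℝ (Fin dy) → EReal
  K : EuclideanSpace ℝ (Fin dx) →L[ℝ] EuclideanSpace ℝ (Fin dy)
  muX : ℝ
  LX : ℝ
  muXY : ℝ

namespace SaddleProblem

variable {dx dy : ℕ} (P : SaddleProblem dx dy)

/-- `Kᵀ`. -/
abbrev Kt : EuclideanSpace ℝ (Fin dy) →L[ℝ] EuclideanSpace ℝ (Fin dx) :=
  ContinuousLinearMap.adjoint P.K

/-- `L_xy = max {‖K x‖ : ‖x‖ = 1}`, the operator norm of `K`. -/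
def LXY : ℝ := ‖P.K‖

/-- `κ_x = L_x / μ_x`. -/
def kappaX : ℝ := P.LX / P.muX

/-- `κ_xy = L_xy / μ_xy`. -/
def kappaXY : ℝ := P.LXY / P.muXY

/-- `F⋆`. -/
def Fstar : EuclideanSpace ℝ (Fin dy) → EReal := conjugate P.F

/-- `G(x) + ⟨y, K x⟩ - F⋆(y)`. -/
def lagrangian (x : EuclideanSpace ℝ (Fin dx)) (y : EuclideanSpace ℝ (Fin dy)) : EReal :=
  ((P.G x + ⟪y, P.K x⟫_ℝ : ℝ) : EReal) - P.Fstar y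

/-- `(x⋆, y⋆)` is a saddle point with `y⋆ ∈ dom F⋆`. -/
structure IsSolution (xs : EuclideanSpace ℝ (Fin dx)) (ys : EuclideanSpace ℝ (Fin dy)) :
    Prop where
  mem_dom : P.Fstar ys ≠ ⊤
  min_x : ∀ x, P.lagrangian xs ys ≤ P.lagrangian x ys
  max_y : ∀ y, P.lagrangian xs y ≤ P.lagrangian xs ys

/-- The standing assumptions: `G` is differentiable, `μ_x`-strongly convex and `L_x`-smooth, `F` is
proper, closed and convex, `K ≠ 0`, the spectral condition that defines `μ_xy` holds, and the problem
has a solution. -/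
structure Standing : Prop where
  muX_pos : 0 < P.muX
  differentiable : Differentiable ℝ P.G
  strongly_convex : ∀ x' x'' : EuclideanSpace ℝ (Fin dx),
    P.muX / 2 * ‖x' - x''‖ ^ 2 ≤ P.G x' - P.G x'' - ⟪∇ P.G x'', x' - x''⟫_ℝ
  smooth : ∀ x' x'' : EuclideanSpace ℝ (Fin dx),
    ‖∇ P.G x' - ∇ P.G x''‖ ≤ P.LX * ‖x' - x''‖
  F_convex : IsProperClosedConvex P.F
  K_ne_zero : P.K ≠ 0
  muXY_pos : 0 < P.muXY
  muXY_le_of_range : (∀ y, subdifferential P.Fstar y ⊆ Set.range P.K) →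
    P.muXY ^ 2 ≤ lambdaMinPos (P.K ∘L P.Kt)
  muXY_le_of_not_range : (¬ ∀ y, subdifferential P.Fstar y ⊆ Set.range P.K) →
    P.muXY ^ 2 ≤ lambdaMin (P.K ∘L P.Kt)
  solvable : ∃ xs ys, P.IsSolution xs ys

/-! ### The algorithm -/

/-- Parameters of the algorithm. -/
structure StepParams where
  etaX : ℝ
  etaY : ℝ
  betaY : ℝ
  theta : ℝ
  T : ℕ

/-- `Ψ(u) = G(u) + ‖u - (x - η Kᵀ ȳ)‖² / (2 η)`. One evaluation of `∇Ψ` costs one evaluation of `∇G`. -/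
def auxiliary (eta : ℝ) (x : EuclideanSpace ℝ (Fin dx)) (ybar : EuclideanSpace ℝ (Fin dy)) :
    EuclideanSpace ℝ (Fin dx) → ℝ :=
  fun u => P.G u + 1 / (2 * eta) * ‖u - (x - eta • P.Kt ybar)‖ ^ 2

/-- A run of APDA with inexact prox. `xhat k` is the output of the inner method applied to the
auxiliary function `Ψ^k` from the starting point `x k`, and `wstar k` is the exact minimizer of `Ψ^k`.
`nProx k` and `nGrad k` are the numbers of evaluations of the prox of `F⋆` and of `∇G` made during the
first `k` iterations. -/
structure Run (dx dy : ℕ) where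
  x : ℕ → EuclideanSpace ℝ (Fin dx)
  y : ℕ → EuclideanSpace ℝ (Fin dy)
  ybar : ℕ → EuclideanSpace ℝ (Fin dy)
  xhat : ℕ → EuclideanSpace ℝ (Fin dx)
  wstar : ℕ → EuclideanSpace ℝ (Fin dx)
  nProx : ℕ → ℕ
  nGrad : ℕ → ℕ

/-- `R` is the run of the algorithm with inner method `M` and parameters `p` from `(x⁰, y⁰)`. -/
structure IsRun (M : GradientMethod (EuclideanSpace ℝ (Fin dx))) (p : StepParams)
    (x₀ : EuclideanSpace ℝ (Fin dx)) (y₀ : EuclideanSpace ℝ (Fin dy)) (R : Run dx dy) : Prop where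
  x_zero : R.x 0 = x₀
  y_zero : R.y 0 = y₀
  ybar_zero : R.ybar 0 = y₀
  wstar_min : ∀ k, IsMinOn (P.auxiliary p.etaX (R.x k) (R.ybar k)) Set.univ (R.wstar k)
  /-- `Ψ^k` is `(L_x + 1 / η_x)`-smooth; the inner method makes `T` iterations. -/
  xhat_eq : ∀ k, R.xhat k = (M (P.LX + 1 / p.etaX) p.T (R.x k)).eval
    (∇ (P.auxiliary p.etaX (R.x k) (R.ybar k)))
  x_succ : ∀ k, R.x (k + 1) = R.x k - p.etaX • (∇ P.G (R.xhat k) + P.Kt (R.ybar k))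
  /-- The implicit step, which is one evaluation of the prox of `η_y F⋆`. -/
  y_succ : ∀ k, ∃ g ∈ subdifferential P.Fstar (R.y (k + 1)),
    R.y (k + 1) = R.y k - p.etaY • (g - P.K (R.xhat k))
      - (p.etaY * p.betaY) • P.K (P.Kt (R.y k) + ∇ P.G (R.xhat k))
  ybar_succ : ∀ k, R.ybar (k + 1) = R.y (k + 1) + p.theta • (R.y (k + 1) - R.y k)
  nProx_zero : R.nProx 0 = 0
  nProx_succ : ∀ k, R.nProx (k + 1) = R.nProx k + 1
  nGrad_zero : R.nGrad 0 = 0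
  /-- The gradients evaluated by the inner method, and `∇G` at `xhat k`. -/
  nGrad_succ : ∀ k, R.nGrad (k + 1) = R.nGrad k +
    (M (P.LX + 1 / p.etaX) p.T (R.x k)).cost (∇ (P.auxiliary p.etaX (R.x k) (R.ybar k))) + 1

/-- The primal stepsize `η_x`. -/
def etaX : ℝ := 1 / (4 * √(P.LX * P.muX)) * (P.muXY / P.LXY)

/-- The dual stepsize `η_y`. -/
def etaY : ℝ := √(P.LX * P.muX) / (8 * P.LXY * P.muXY)

/-- The stepsize `β_y`. -/
def betaY : ℝ := min (1 / P.LX) (1 / (2 * P.LXY ^ 2 * P.etaY))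

/-- The extrapolation parameter and contraction factor `θ`. -/
def theta : ℝ := max (2 / (2 + P.muX * P.etaX)) (1 - P.muXY ^ 2 * P.betaY * P.etaY)

/-- The choice of parameters `η_x, η_y, β_y, θ`, with `T` inner iterations. -/
def params (T : ℕ) : StepParams where
  etaX := P.etaX
  etaY := P.etaY
  betaY := P.betaY
  theta := P.theta
  T := T

/-- `(20 A)^{1/α} (1 + √(L_x / μ_x))^{2/α}`. -/
def innerIterations (A α : ℝ) : ℝ :=
  (20 * A) ^ (1 / α) * (1 + √(P.LX / P.muX)) ^ (2 / α)

/-- The Lyapunov function `Δ^k`. -/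
def lyapunov (p : StepParams) (R : Run dx dy) (xs : EuclideanSpace ℝ (Fin dx))
    (ys : EuclideanSpace ℝ (Fin dy)) : ℕ → ℝ
  | 0 => (1 + P.muX * p.etaX / 2) * (1 / p.etaX) * ‖R.x 0 - xs‖ ^ 2
      + 1 / p.etaY * ‖R.y 0 - ys‖ ^ 2
  | k + 1 => (1 + P.muX * p.etaX / 2) * (1 / p.etaX) * ‖R.x (k + 1) - xs‖ ^ 2
      + 1 / p.etaY * ‖R.y (k + 1) - ys‖ ^ 2
      + 1 / (2 * p.etaY) * ‖R.y (k + 1) - R.y k‖ ^ 2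
      + 1 / (8 * p.etaX) * ‖R.x k - R.wstar k‖ ^ 2
      - 2 * ⟪P.Kt (R.y (k + 1)) - P.Kt (R.y k), R.xhat k - xs⟫_ℝ

/-- The pair `(x⋆, y⋆)` is a solution with `y⋆ - y⁰` in the range of `K`. If `K` is onto, this is any
solution; otherwise the component of the dual iterates orthogonal to the range of `K` never changes,
and the dual solution with the same component is meant. -/
def IsReachableSolution (y₀ : EuclideanSpace ℝ (Fin dy)) (xs : EuclideanSpace ℝ (Fin dx))
    (ys : EuclideanSpace ℝ (Fin dy)) : Prop :=
  P.IsSolution xs ys ∧ ys - y₀ ∈ Set.range P.K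

/-- From every starting point, the algorithm with inner method `M` and parameters `p` reaches
`Δ^k ≤ ε Δ^0` within `nP` evaluations of the prox of `F⋆` and `nG` evaluations of `∇G`, and `Δ^k ≤ ε Δ^0`
holds from then on. -/
def SolvesWithin (M : GradientMethod (EuclideanSpace ℝ (Fin dx))) (p : StepParams)
    (ε nP nG : ℝ) : Prop :=
  ∃ N : ℕ, ∀ x₀ y₀ R, P.IsRun M p x₀ y₀ R →
    (R.nProx N : ℝ) ≤ nP ∧ (R.nGrad N : ℝ) ≤ nG ∧
    ∀ xs ys, P.IsReachableSolution y₀ xs ys →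
      ∀ k ≥ N, P.lyapunov p R xs ys k ≤ ε * P.lyapunov p R xs ys 0

end SaddleProblem

end

/-! Since `∇Ψ^k(u) = ∇G(u) + (u - x^k)/η_x + Kᵀȳ^k`, the primal update satisfies `x^{k+1} - x̂^k =
-η_x ∇Ψ^k(x̂^k)`. It is thus an implicit step at `x̂^k` whose error is a gradient norm, which is why
the inner method is judged by gradients and not by values. Because `η_x (L_x + 1/η_x) ≤ 1 + √κ_x`,
the prescribed number of inner iterations makes the squared error at most `‖x^k - w⋆^k‖² / 20`,
uniformly in `k` (`inner_accuracy`, `run_accuracy`).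

Primal contraction comes from strong convexity of `G`. Dual contraction comes from the extra term
`β_y K(Kᵀy + ∇G(x̂))`: by optimality it equals `β_y K(Kᵀ(y - y⋆) + ∇G(x̂) - ∇G(x⋆))`, so it yields
`-β_y ‖Kᵀ(y - y⋆)‖²`, hence `-β_y μ_xy² ‖y - y⋆‖²` as long as `y - y⋆` lies in the range of `K`. The
range is invariant because the subgradients of `F⋆` lie in it (`run_range`). `distance_step`
collects these gains. The extrapolation `ȳ` makes the bilinear terms telescope with the inner
product in the Lyapunov function, and `energy_step` pays for the remainders with `-‖x - x̂‖²/η_x`.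

A solution in `y⁰ + range K` exists because `dom F` is contained in the closed set `range K`
(`dom_subset`), so `F⋆` is constant along the orthogonal complement. It is unique by strong
convexity and injectivity of `Kᵀ` on the range.

Since `1/(1 - θ)` is at most `9 max(√κ_x κ_xy, κ_xy²)`, the oracle counts follow by multiplying the
outer and inner iteration numbers. The three concrete rates are proved by potential functions:
`gdLoop_potential` and `gdLoop_value` for GD, `fgd_step` for FGD, and `fsfomEnergy_step` for the
Kim--Fessler method. -/

section MethodCost

/-! ### Oracle counts of the inner methods. -/

theorem GradientProgram.eval_andThen {E : Type*} (g : E → E) (p : GradientProgram E)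
    (q : E → GradientProgram E) : (p.andThen q).eval g = (q (p.eval g)).eval g := by
  induction p with
  | ret w => rfl
  | query p next ih => exact ih (g p)

theorem GradientProgram.cost_andThen {E : Type*} (g : E → E) (p : GradientProgram E)
    (q : E → GradientProgram E) :
    (p.andThen q).cost g = p.cost g + (q (p.eval g)).cost g := by
  induction p with
  | ret w => simp [GradientProgram.andThen, GradientProgram.cost, GradientProgram.eval]
  | query p next ih =>
    simp only [GradientProgram.andThen, GradientProgram.cost, GradientProgram.eval, ih (g p)]
    omega

theorem halfHalf_cost_le {E : Type*} {M₁ M₂ : GradientMethod E}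
    (h₁ : ∀ (L : ℝ) (T : ℕ) (w : E) (g : E → E), (M₁ L T w).cost g ≤ T)
    (h₂ : ∀ (L : ℝ) (T : ℕ) (w : E) (g : E → E), (M₂ L T w).cost g ≤ T)
    (L : ℝ) (T : ℕ) (w : E) (g : E → E) : (halfHalf M₁ M₂ L T w).cost g ≤ T := by
  rw [halfHalf, GradientProgram.cost_andThen]
  have := h₁ L (T / 2) w g
  have := h₂ L (T - T / 2) ((M₁ L (T / 2) w).eval g) g
  omega

variable {E : Type*} [NormedAddCommGroup E] [InnerProductSpace ℝ E]

theorem gdLoop_cost (L : ℝ) (g : E → E) (n : ℕ) : ∀ w, (gdLoop L n w).cost g = n := by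
  induction n with
  | zero => intro w; rfl
  | succ n ih => intro w; simp [gdLoop, GradientProgram.cost, ih]

theorem fgdLoop_cost (L : ℝ) (g : E → E) (n : ℕ) :
    ∀ x z t, (fgdLoop L n x z t).cost g = n := by
  induction n with
  | zero => intro x z t; rfl
  | succ n ih => intro x z t; simp [fgdLoop, GradientProgram.cost, ih]

theorem fsfomLoop_cost (L : ℝ) (N : ℕ) (g : E → E) (n : ℕ) :
    ∀ x y, (fsfomLoop L N n x y).cost g = n := by
  induction n with
  | zero => intro x y; rfl
  | succ n ih => intro x y; simp [fsfomLoop, GradientProgram.cost, ih]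

end MethodCost

/-! ### Inequalities for smooth convex functions, and gradient descent. -/

section SmoothConvex

variable {E : Type*} [NormedAddCommGroup E] [InnerProductSpace ℝ E] [CompleteSpace E]

theorem hasDerivAt_comp_line {f : E → ℝ} (hf : Differentiable ℝ f) (u d : E) (t : ℝ) :
    HasDerivAt (fun s : ℝ => f (u + s • d)) ⟪∇ f (u + t • d), d⟫_ℝ t := by
  have h1 : HasDerivAt (fun s : ℝ => u + s • d) d t := by
    simpa using ((hasDerivAt_id t).smul_const d).const_add u
  have h2 := (hf (u + t • d)).hasFDerivAt.comp_hasDerivAt t h1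
  rw [inner_gradient_left]
  exact h2

theorem ConvexOn.gradient_inequality {f : E → ℝ} (hc : ConvexOn ℝ Set.univ f)
    (hf : Differentiable ℝ f) (u v : E) : f u + ⟪∇ f u, v - u⟫_ℝ ≤ f v := by
  have hd := hasDerivAt_comp_line hf u (v - u) 0
  have hg : ConvexOn ℝ Set.univ (fun s : ℝ => f (u + s • (v - u))) := by
    refine ⟨convex_univ, fun a _ b _ p q hp hq hpq => ?_⟩
    have := hc.2 (Set.mem_univ (u + a • (v - u))) (Set.mem_univ (u + b • (v - u))) hp hq hpq
    refine le_trans (le_of_eq ?_) this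
    change f (u + (p * a + q * b) • (v - u)) = _
    congr 1
    have hp' : p = 1 - q := by linarith
    subst hp'
    module
  have := hg.le_slope_of_hasDerivAt (Set.mem_univ 0) (Set.mem_univ 1) one_pos hd
  simp only [slope_def_field, zero_smul, add_zero, one_smul, add_sub_cancel, sub_zero,
    div_one] at this
  linarith

theorem convexOn_of_gradient_inequality {f : E → ℝ}
    (h : ∀ u v : E, f u + ⟪∇ f u, v - u⟫_ℝ ≤ f v) : ConvexOn ℝ Set.univ f := by
  refine ⟨convex_univ, fun x _ y _ a b ha hb hab => ?_⟩
  set z := a • x + b • y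
  have h1 := mul_le_mul_of_nonneg_left (h z x) ha
  have h2 := mul_le_mul_of_nonneg_left (h z y) hb
  have h3 : a * ⟪∇ f z, x - z⟫_ℝ + b * ⟪∇ f z, y - z⟫_ℝ = 0 := by
    rw [← real_inner_smul_right, ← real_inner_smul_right, ← inner_add_right]
    have : a • (x - z) + b • (y - z) = 0 := by
      have hb' : b = 1 - a := by linarith
      simp only [z, hb']
      module
    rw [this, inner_zero_right]
  have h4 : f z = a * f z + b * f z := by rw [← add_mul, hab, one_mul]
  simp only [smul_eq_mul]
  linarith

theorem IsSmoothWith.descent {L : ℝ} {f : E → ℝ} (hs : IsSmoothWith L f) (u v : E) :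
    f v ≤ f u + ⟪∇ f u, v - u⟫_ℝ + L / 2 * ‖v - u‖ ^ 2 := by
  set d := v - u with hd
  set ψ : ℝ → ℝ := fun t => f (u + t • d) - t * ⟪∇ f u, d⟫_ℝ - L / 2 * ‖d‖ ^ 2 * t ^ 2
  have hder : ∀ t, HasDerivAt ψ
      (⟪∇ f (u + t • d), d⟫_ℝ - ⟪∇ f u, d⟫_ℝ - L * ‖d‖ ^ 2 * t) t := by
    intro t
    have h1 := ((hasDerivAt_comp_line hs.1 u d t).sub
      ((hasDerivAt_id t).mul_const ⟪∇ f u, d⟫_ℝ)).sub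
      (((hasDerivAt_id t).pow 2).const_mul (L / 2 * ‖d‖ ^ 2))
    refine h1.congr_deriv ?_
    simp
    ring
  have hanti : AntitoneOn ψ (Set.Icc 0 1) := by
    refine antitoneOn_of_deriv_nonpos (convex_Icc 0 1)
      (fun t _ => (hder t).continuousAt.continuousWithinAt)
      (fun t _ => (hder t).differentiableAt.differentiableWithinAt) fun t ht => ?_
    rw [interior_Icc] at ht
    rw [(hder t).deriv, ← inner_sub_left]
    have h2 := real_inner_le_norm (∇ f (u + t • d) - ∇ f u) d
    have h3 := hs.2 (u + t • d) u
    have h4 : ‖u + t • d - u‖ = t * ‖d‖ := by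
      rw [add_sub_cancel_left, norm_smul, Real.norm_of_nonneg ht.1.le]
    rw [h4] at h3
    nlinarith [mul_le_mul_of_nonneg_right h3 (norm_nonneg d)]
  have := hanti (Set.left_mem_Icc.2 zero_le_one) (Set.right_mem_Icc.2 zero_le_one) zero_le_one
  simp only [ψ, one_smul, zero_smul, hd, add_sub_cancel] at this
  simp only [add_zero] at this
  linarith

/-- The interpolation inequality of smooth convex functions. -/
theorem IsSmoothWith.interpolation {L : ℝ} {f : E → ℝ} (hL : 0 < L)
    (hs : IsSmoothWith L f) (hc : ConvexOn ℝ Set.univ f) (u v : E) :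
    f u + ⟪∇ f u, v - u⟫_ℝ + 1 / (2 * L) * ‖∇ f v - ∇ f u‖ ^ 2 ≤ f v := by
  set g := ∇ f v - ∇ f u with hg
  -- The tangent lower bound at `u` and the quadratic upper bound at `v` are compared at `v - g/L`,
  -- the minimizer of the difference of the two bounds.
  have h1 := hc.gradient_inequality hs.1 u (v - (1 / L) • g)
  have h2 := hs.descent v (v - (1 / L) • g)
  have h3 : v - (1 / L) • g - u = (v - u) - (1 / L) • g := by abel
  have h4 : v - (1 / L) • g - v = -((1 / L) • g) := by abel
  have h6 : ⟪∇ f v, g⟫_ℝ - ⟪∇ f u, g⟫_ℝ = ‖g‖ ^ 2 := by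
    rw [← inner_sub_left, ← hg, real_inner_self_eq_norm_sq]
  rw [h3, inner_sub_right, inner_smul_right] at h1
  rw [h4, inner_neg_right, inner_smul_right, norm_neg, norm_smul, mul_pow,
    Real.norm_of_nonneg (by positivity)] at h2
  have h7 : L / 2 * ((1 / L) ^ 2 * ‖g‖ ^ 2) = 1 / (2 * L) * ‖g‖ ^ 2 := by field_simp
  have h8 : 1 / L * (⟪∇ f v, g⟫_ℝ - ⟪∇ f u, g⟫_ℝ) = 2 * (1 / (2 * L) * ‖g‖ ^ 2) := by
    rw [h6]; field_simp
  rw [h7] at h2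
  linarith

theorem IsMinOn.gradient_eq_zero {f : E → ℝ} {w : E} (h : IsMinOn f Set.univ w) : ∇ f w = 0 := by
  have : fderiv ℝ f w = 0 := (h.isLocalMin Filter.univ_mem).fderiv_eq_zero
  simp [gradient, this]

theorem IsSmoothWith.norm_gradient_sq_le {L : ℝ} {f : E → ℝ} (hL : 0 < L)
    (hs : IsSmoothWith L f) (hc : ConvexOn ℝ Set.univ f) {w : E} (hw : IsMinOn f Set.univ w)
    (u : E) : 1 / (2 * L) * ‖∇ f u‖ ^ 2 ≤ f u - f w := by
  have := hs.interpolation hL hc w u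
  rw [hw.gradient_eq_zero] at this
  simp only [inner_zero_left, sub_zero] at this
  linarith

theorem IsSmoothWith.sub_min_le {L : ℝ} {f : E → ℝ}
    (hs : IsSmoothWith L f) {w : E} (hw : IsMinOn f Set.univ w)
    (u : E) : f u - f w ≤ L / 2 * ‖u - w‖ ^ 2 := by
  have := hs.descent w u
  rw [hw.gradient_eq_zero] at this
  simp only [inner_zero_left] at this
  linarith

/-- Cocoercivity of the gradient. -/
theorem IsSmoothWith.cocoercive {L : ℝ} {f : E → ℝ} (hL : 0 < L)
    (hs : IsSmoothWith L f) (hc : ConvexOn ℝ Set.univ f) (u v : E) :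
    1 / L * ‖∇ f u - ∇ f v‖ ^ 2 ≤ ⟪∇ f u - ∇ f v, u - v⟫_ℝ := by
  have h1 := hs.interpolation hL hc u v
  have h2 := hs.interpolation hL hc v u
  rw [norm_sub_rev] at h1
  have h3 : ⟪∇ f u, v - u⟫_ℝ = -⟪∇ f u, u - v⟫_ℝ := by rw [← inner_neg_right, neg_sub]
  have h4 : 1 / L * ‖∇ f u - ∇ f v‖ ^ 2 = 2 * (1 / (2 * L) * ‖∇ f u - ∇ f v‖ ^ 2) := by
    field_simp
  rw [inner_sub_left]
  linarith

/-! ### Gradient descent -/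

section GradientDescent

variable {L : ℝ} {f : E → ℝ}

theorem IsSmoothWith.gradient_step_le (hL : 0 < L) (hs : IsSmoothWith L f) (w : E) :
    f (w - (1 / L) • ∇ f w) ≤ f w - 1 / (2 * L) * ‖∇ f w‖ ^ 2 := by
  have h2 := hs.descent w (w - (1 / L) • ∇ f w)
  have h4 : w - (1 / L) • ∇ f w - w = -((1 / L) • ∇ f w) := by abel
  rw [h4, inner_neg_right, inner_smul_right, norm_neg, norm_smul, mul_pow,
    Real.norm_of_nonneg (by positivity), real_inner_self_eq_norm_sq] at h2
  have h7 : L / 2 * ((1 / L) ^ 2 * ‖∇ f w‖ ^ 2) = 1 / (2 * L) * ‖∇ f w‖ ^ 2 := by field_simp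
  have h8 : 1 / L * ‖∇ f w‖ ^ 2 = 2 * (1 / (2 * L) * ‖∇ f w‖ ^ 2) := by field_simp
  linarith

/-- With `g` and `h'` the gradients before and after the step, cocoercivity gives `‖h'‖² ≤ ⟪h', g⟫`.
-/
theorem IsSmoothWith.norm_gradient_step_le (hL : 0 < L) (hs : IsSmoothWith L f)
    (hc : ConvexOn ℝ Set.univ f) (w : E) :
    ‖∇ f (w - (1 / L) • ∇ f w)‖ ^ 2 ≤ ‖∇ f w‖ ^ 2 := by
  have h := hs.cocoercive hL hc (w - (1 / L) • ∇ f w) w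
  set g := ∇ f w
  set h' := ∇ f (w - (1 / L) • g)
  have e : w - (1 / L) • g - w = -((1 / L) • g) := by abel
  rw [e, inner_neg_right, inner_smul_right, inner_sub_left, real_inner_self_eq_norm_sq,
    norm_sub_sq_real] at h
  have hL' : (0 : ℝ) < 1 / L := by positivity
  have h2 : ‖h'‖ ^ 2 - 2 * ⟪h', g⟫_ℝ + ‖g‖ ^ 2 ≤ -(⟪h', g⟫_ℝ - ‖g‖ ^ 2) :=
    le_of_mul_le_mul_left (by linarith) hL'
  have h3 := sq_nonneg ‖h' - g‖
  rw [norm_sub_sq_real] at h3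
  linarith

theorem norm_gradient_step_sub_le (hL : 0 < L) (hs : IsSmoothWith L f)
    (hc : ConvexOn ℝ Set.univ f) {ws : E} (hw : IsMinOn f Set.univ ws) (w : E) :
    L / 2 * ‖w - (1 / L) • ∇ f w - ws‖ ^ 2 ≤ L / 2 * ‖w - ws‖ ^ 2 - (f w - f ws) := by
  have h := hs.interpolation hL hc w ws
  rw [hw.gradient_eq_zero, zero_sub, norm_neg] at h
  have e : w - (1 / L) • ∇ f w - ws = (w - ws) - (1 / L) • ∇ f w := by abel
  rw [e, norm_sub_sq_real (w - ws), norm_smul, mul_pow, Real.norm_of_nonneg (by positivity),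
    inner_smul_right, real_inner_comm]
  have h3 : ⟪∇ f w, ws - w⟫_ℝ = -⟪∇ f w, w - ws⟫_ℝ := by rw [← inner_neg_right, neg_sub]
  have h5 : L / 2 * (‖w - ws‖ ^ 2 - 2 * (1 / L * ⟪∇ f w, w - ws⟫_ℝ) + (1 / L) ^ 2 * ‖∇ f w‖ ^ 2)
    = L / 2 * ‖w - ws‖ ^ 2 - ⟪∇ f w, w - ws⟫_ℝ + 1 / (2 * L) * ‖∇ f w‖ ^ 2 := by
    field_simp
  rw [h5]
  linarith

/-- The potential `c‖∇f‖² + a(f - f⋆) + (L/2)‖w - w⋆‖²` does not increase when `a` becomes `a + 1`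
and `c` becomes `c + (a + 1)/(2L)`: the drop in squared distance pays for the extra copy of `f -
f⋆`, and the drop of `(a + 1) f` pays for the growth of `c`. Summing the increments of `c` gives the
quadratic coefficient. The weights `a`, `c` are left free so that the induction can change them. -/
theorem gdLoop_potential (hL : 0 < L) (hs : IsSmoothWith L f)
    (hc : ConvexOn ℝ Set.univ f) {ws : E} (hw : IsMinOn f Set.univ ws) (n : ℕ) :
    ∀ (a c : ℝ) (w : E), 0 ≤ a → 0 ≤ c →
      (c + (n * (2 * a + n + 1)) / (4 * L)) * ‖∇ f ((gdLoop L n w).eval (∇ f))‖ ^ 2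
        + (a + n) * (f ((gdLoop L n w).eval (∇ f)) - f ws)
        ≤ c * ‖∇ f w‖ ^ 2 + a * (f w - f ws) + L / 2 * ‖w - ws‖ ^ 2 := by
  induction n with
  | zero =>
    intro a c w ha hcc
    simp only [gdLoop, GradientProgram.eval, Nat.cast_zero, zero_mul, zero_div, add_zero]
    have : 0 ≤ L / 2 * ‖w - ws‖ ^ 2 := by positivity
    linarith
  | succ n ih =>
    intro a c w ha hcc
    simp only [gdLoop, GradientProgram.eval]
    set w' := w - (1 / L) • ∇ f w with hw'
    have h0 : 0 ≤ c + (a + 1) / (2 * L) := by positivity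
    have h := ih (a + 1) (c + (a + 1) / (2 * L)) w' (by linarith) h0
    have h1 := hs.gradient_step_le hL w
    have h2 := hs.norm_gradient_step_le hL hc w
    have h3 := norm_gradient_step_sub_le hL hs hc hw w
    rw [← hw'] at h1 h2 h3
    have h4 := mul_le_mul_of_nonneg_left h2 h0
    have h5 := mul_le_mul_of_nonneg_left h1 (by linarith : 0 ≤ a + 1)
    have e1 : c + (a + 1) / (2 * L) + ↑n * (2 * (a + 1) + ↑n + 1) / (4 * L)
        = c + ((n + 1 : ℕ) * (2 * a + (n + 1 : ℕ) + 1)) / (4 * L) := by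
      push_cast; field_simp; ring
    have e2 : a + 1 + (n : ℝ) = a + (n + 1 : ℕ) := by push_cast; ring
    rw [e1, e2] at h
    refine h.trans ?_
    have e3 : (a + 1) / (2 * L) * ‖∇ f w‖ ^ 2 = (a + 1) * (1 / (2 * L) * ‖∇ f w‖ ^ 2) := by
      field_simp
    rw [add_mul c _ (‖∇ f w‖ ^ 2), e3] at h4
    linarith

/-- The same accounting without the distance term. Each step moves `1/(2L)` from the value gap to
the weight of the squared gradient, and the final value gap supplies one more, hence `n + 1`. -/
theorem gdLoop_value (hL : 0 < L) (hs : IsSmoothWith L f)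
    (hc : ConvexOn ℝ Set.univ f) {ws : E} (hw : IsMinOn f Set.univ ws) (n : ℕ) :
    ∀ (c : ℝ) (w : E), 0 ≤ c →
      (c + (n + 1) / (2 * L)) * ‖∇ f ((gdLoop L n w).eval (∇ f))‖ ^ 2
        ≤ c * ‖∇ f w‖ ^ 2 + (f w - f ws) := by
  induction n with
  | zero =>
    intro c w hcc
    have := hs.norm_gradient_sq_le hL hc hw w
    simp only [gdLoop, GradientProgram.eval, Nat.cast_zero, zero_add]
    linarith
  | succ n ih =>
    intro c w hcc
    simp only [gdLoop, GradientProgram.eval]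
    set w' := w - (1 / L) • ∇ f w with hw'
    have h0 : 0 ≤ c + 1 / (2 * L) := by positivity
    have h := ih (c + 1 / (2 * L)) w' h0
    have h1 := hs.gradient_step_le hL w
    have h2 := mul_le_mul_of_nonneg_left (hs.norm_gradient_step_le hL hc w) h0
    rw [← hw'] at h1 h2
    have e1 : c + 1 / (2 * L) + (n + 1) / (2 * L) = c + ((n + 1 : ℕ) + 1) / (2 * L) := by
      push_cast; field_simp; ring
    rw [e1] at h
    linarith

theorem gd_hasGradientRate : HasGradientRate (gd (E := E)) 4 2 := by
  refine ⟨fun L T w g => (gdLoop_cost L g T w).le, ?_⟩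
  intro L f hL hc hs ws hw w T hT
  have h := gdLoop_potential hL hs hc hw T 0 0 w le_rfl le_rfl
  have h1 := hs.norm_gradient_sq_le hL hc hw ((gdLoop L T w).eval (∇ f))
  have hT' : (1 : ℝ) ≤ T := by exact_mod_cast hT
  change ‖∇ f ((gdLoop L T w).eval (∇ f))‖ ^ 2 ≤ _
  set r := ‖∇ f ((gdLoop L T w).eval (∇ f))‖ ^ 2
  have hr : 0 ≤ r := by positivity
  -- The value gap `T (f - f⋆)` left in the potential is also turned into a squared gradient,
  -- raising `T(T + 1)` to `T(T + 3)`.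
  have h2 := mul_le_mul_of_nonneg_left h1 (by linarith : (0 : ℝ) ≤ T)
  rw [show ((T : ℝ)) ^ (2 : ℝ) = (T : ℝ) ^ 2 by norm_cast, le_div_iff₀ (by positivity)]
  have h3 : (T * (T + 3) / (4 * L)) * r ≤ L / 2 * ‖w - ws‖ ^ 2 := by
    have : (T * (T + 3) / (4 * L)) * r =
      (0 + (T * (2 * 0 + T + 1)) / (4 * L)) * r + T * (1 / (2 * L) * r) := by
      field_simp; ring
    rw [this]; linarith
  rw [div_mul_eq_mul_div, div_le_iff₀ (by positivity)] at h3
  nlinarith [mul_nonneg hr (by linarith : (0 : ℝ) ≤ T), sq_nonneg (L * ‖w - ws‖)]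

end GradientDescent

end SmoothConvex

/-! ### Nesterov's method, and the algebra of the Kim--Fessler method. -/

section AcceleratedMethods

theorem nesterov_sq_sub (t : ℝ) :
    ((1 + √(1 + 4 * t ^ 2)) / 2) ^ 2 - (1 + √(1 + 4 * t ^ 2)) / 2 = t ^ 2 := by
  have := Real.sq_sqrt (by positivity : (0 : ℝ) ≤ 1 + 4 * t ^ 2)
  nlinarith

theorem nesterov_ge (t : ℝ) : t + 1 / 2 ≤ (1 + √(1 + 4 * t ^ 2)) / 2 := by
  have : 2 * t ≤ √(1 + 4 * t ^ 2) := Real.le_sqrt_of_sq_le (by nlinarith)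
  linarith

/-- The certificate for one step: new energy equals old energy minus two interpolation gaps, between
consecutive iterates with weight `1/q` and between the current and the final point with weight `1/q
- 1/a²`. Here `q` is the square of the next coefficient, `m` the gradient at the final point and `w`
the vector from the current to the final point. -/
theorem fsfom_identity {E : Type*} [NormedAddCommGroup E] [InnerProductSpace ℝ E]
    (L a q c fx fh fX : ℝ) (hL : L ≠ 0) (ha : a ≠ 0) (ha1 : a - 1 ≠ 0)
    (hq : q = a * (a - 1)) (r g h m w : E) :
    1 / q * (1 / (2 * L) * ‖m‖ ^ 2 + 1 / (2 * L) * ‖h‖ ^ 2 + fh - fX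
        - ⟪h, c • (((a - 1) ^ 2 / a ^ 2) • r - ((a - 1) / L) • g)⟫_ℝ)
      + L / q ^ 2 * ⟪((a - 1) ^ 2 / a ^ 2) • r - ((a - 1) / L) • g,
          ((a - 1) ^ 2 / a ^ 2) • r - w + (1 / L) • m - (a / L) • g⟫_ℝ
    = 1 / a ^ 2 * (1 / (2 * L) * ‖m‖ ^ 2 + 1 / (2 * L) * ‖g‖ ^ 2 + fx - fX
        - ⟪g, ((2 * a - 1) / a ^ 2) • r⟫_ℝ)
      + L / a ^ 4 * ⟪r, ((a - 1) ^ 2 / a ^ 2) • r - w + (1 / L) • m⟫_ℝ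
      - 1 / q * (fx - fh
          - ⟪h, (1 / L) • g - c • (((a - 1) ^ 2 / a ^ 2) • r - ((a - 1) / L) • g)⟫_ℝ
          - 1 / (2 * L) * ‖g - h‖ ^ 2)
      - (1 / q - 1 / a ^ 2) * (fX - fx - ⟪g, w⟫_ℝ - 1 / (2 * L) * ‖m - g‖ ^ 2) := by
  subst hq
  simp only [← real_inner_self_eq_norm_sq, inner_add_right, inner_sub_left,
    inner_sub_right, real_inner_smul_left, real_inner_smul_right, real_inner_comm r g,
    real_inner_comm g h, real_inner_comm m g, real_inner_comm r h, real_inner_comm w g]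
  field_simp
  ring

variable {E : Type*} [NormedAddCommGroup E] [InnerProductSpace ℝ E] [CompleteSpace E]
variable {L : ℝ} {f : E → ℝ}

/-- The momentum coefficient is chosen so that `t z - (t - 1) x` moves by exactly `-(t/L) ∇f(z)`.
Expanding the square and using convexity at `z` towards `x` with weight `t - 1` and towards `ws`
with weight `1` gives the decrease; `t'² - t' = t²` matches the weights. -/
theorem fgd_step (hL : 0 < L) (hs : IsSmoothWith L f) (hc : ConvexOn ℝ Set.univ f)
    (ws x z : E) {t t' : ℝ} (ht : 1 ≤ t) (ht' : t' ^ 2 - t' = t ^ 2) (ht0 : 0 < t') :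
    2 / L * (t' ^ 2 - t') * (f (z - (1 / L) • ∇ f z) - f ws)
      + ‖t' • (z - (1 / L) • ∇ f z + ((t - 1) / t') • (z - (1 / L) • ∇ f z - x))
          - (t' - 1) • (z - (1 / L) • ∇ f z) - ws‖ ^ 2
      ≤ 2 / L * (t ^ 2 - t) * (f x - f ws) + ‖t • z - (t - 1) • x - ws‖ ^ 2 := by
  have h1 := hs.gradient_step_le hL z
  set g := ∇ f z with hg
  set x' := z - (1 / L) • g with hx'
  set p := t • z - (t - 1) • x - ws with hp
  have h2 := hc.gradient_inequality hs.1 z x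
  have h3 := hc.gradient_inequality hs.1 z ws
  rw [← hg] at h2 h3
  have e1 : t' • (x' + ((t - 1) / t') • (x' - x)) - (t' - 1) • x' - ws = p - (t / L) • g := by
    rw [smul_add, smul_smul, mul_div_cancel₀ _ ht0.ne', hp, hx']
    module
  have e2 : ‖p - (t / L) • g‖ ^ 2
      = ‖p‖ ^ 2 - 2 / L * (t * ⟪g, p⟫_ℝ - t ^ 2 * (1 / (2 * L) * ‖g‖ ^ 2)) := by
    rw [norm_sub_sq_real, norm_smul, mul_pow, Real.norm_eq_abs, sq_abs, inner_smul_right,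
      real_inner_comm]
    field_simp
    ring
  have e3 : ⟪g, p⟫_ℝ = -((t - 1) * ⟪g, x - z⟫_ℝ + ⟪g, ws - z⟫_ℝ) := by
    rw [← real_inner_smul_right, ← inner_add_right, ← inner_neg_right]
    congr 1
    rw [hp]
    module
  rw [e1, e2, ht']
  have h4 := mul_le_mul_of_nonneg_left h2 (by linarith : 0 ≤ t - 1)
  have h5 : t * (f x' - f ws) - (t - 1) * (f x - f ws)
      ≤ ⟪g, p⟫_ℝ - t * (1 / (2 * L) * ‖g‖ ^ 2) := by
    have := mul_le_mul_of_nonneg_left h1 (by linarith : 0 ≤ t)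
    rw [e3]
    linarith
  have h6 := mul_le_mul_of_nonneg_left h5 (by positivity : 0 ≤ 2 / L * t)
  linarith

theorem fgdLoop_potential (hL : 0 < L) (hs : IsSmoothWith L f) (hc : ConvexOn ℝ Set.univ f)
    (ws : E) (n : ℕ) : ∀ (x z : E) (t : ℝ), 1 ≤ t → ∃ s : ℝ, t + n / 2 ≤ s ∧
      2 / L * (s ^ 2 - s) * (f ((fgdLoop L n x z t).eval (∇ f)) - f ws)
        ≤ 2 / L * (t ^ 2 - t) * (f x - f ws) + ‖t • z - (t - 1) • x - ws‖ ^ 2 := by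
  induction n with
  | zero =>
    intro x z t ht
    refine ⟨t, by simp, ?_⟩
    simp only [fgdLoop, GradientProgram.eval]
    have := sq_nonneg ‖t • z - (t - 1) • x - ws‖
    linarith
  | succ n ih =>
    intro x z t ht
    have h1 := nesterov_ge t
    obtain ⟨s, hs1, hs2⟩ := ih (z - (1 / L) • ∇ f z)
      (z - (1 / L) • ∇ f z + ((t - 1) / ((1 + √(1 + 4 * t ^ 2)) / 2)) •
        (z - (1 / L) • ∇ f z - x)) ((1 + √(1 + 4 * t ^ 2)) / 2) (by linarith)
    refine ⟨s, by push_cast; linarith, ?_⟩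
    exact hs2.trans (fgd_step hL hs hc ws x z ht (nesterov_sq_sub t) (by linarith))

theorem fgd_value_le (hL : 0 < L) (hs : IsSmoothWith L f) (hc : ConvexOn ℝ Set.univ f)
    {ws : E} (hw : IsMinOn f Set.univ ws) (w : E) (m : ℕ) :
    m * (m + 2) * (f ((fgd L m w).eval (∇ f)) - f ws) ≤ 2 * L * ‖w - ws‖ ^ 2 := by
  -- At `t = 1` the weight `t² - t` vanishes, so only the squared distance remains on the right.
  obtain ⟨s, hs1, hs2⟩ := fgdLoop_potential hL hs hc ws m w w 1 le_rfl
  have hv : 0 ≤ f ((fgd L m w).eval (∇ f)) - f ws := sub_nonneg.2 (hw (Set.mem_univ _))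
  change 2 / L * (s ^ 2 - s) * (f ((fgd L m w).eval (∇ f)) - f ws) ≤ _ at hs2
  simp only [one_pow, sub_self, mul_zero, zero_mul, zero_add, one_smul, zero_smul, sub_zero]
    at hs2
  have hm : (0 : ℝ) ≤ m := Nat.cast_nonneg m
  -- `4(s² - s) = (2s - 1)² - 1` and `2s - 1 ≥ m + 1`.
  have h1 : (m : ℝ) * (m + 2) ≤ 4 * (s ^ 2 - s) := by nlinarith
  have h2 : 4 * (s ^ 2 - s) * (f ((fgd L m w).eval (∇ f)) - f ws)
      = 2 * L * (2 / L * (s ^ 2 - s) * (f ((fgd L m w).eval (∇ f)) - f ws)) := by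
    field_simp; ring
  calc _ ≤ 4 * (s ^ 2 - s) * (f ((fgd L m w).eval (∇ f)) - f ws) :=
        mul_le_mul_of_nonneg_right h1 hv
    _ = _ := h2
    _ ≤ _ := mul_le_mul_of_nonneg_left hs2 (by positivity)

/-- The value bound at the end of the first half of the iterations. -/
theorem fgd_half_value_le (hL : 0 < L) (hs : IsSmoothWith L f) (hc : ConvexOn ℝ Set.univ f)
    {ws : E} (hw : IsMinOn f Set.univ ws) (w : E) {T : ℕ} (hT : 1 ≤ T) :
    (T : ℝ) ^ 2 * (f ((fgd L (T / 2) w).eval (∇ f)) - f ws) ≤ 8 * L * ‖w - ws‖ ^ 2 := by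
  have hv : 0 ≤ f ((fgd L (T / 2) w).eval (∇ f)) - f ws := sub_nonneg.2 (hw (Set.mem_univ _))
  rcases Nat.eq_zero_or_pos (T / 2) with h0 | h0
  -- With `T = 1` the first half is empty, and the quadratic upper bound at the minimizer replaces
  -- the rate.
  · have hT1 : T = 1 := by omega
    subst hT1
    have := hs.sub_min_le hw w
    have h3 : 0 ≤ L * ‖w - ws‖ ^ 2 := by positivity
    simp only [fgd, Nat.reduceDiv, fgdLoop, GradientProgram.eval, Nat.cast_one, one_pow, one_mul]
    linarith
  · have h1 := fgd_value_le hL hs hc hw w (T / 2)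
    have h2 : (T : ℝ) ^ 2 ≤ 4 * ((T / 2 : ℕ) * ((T / 2 : ℕ) + 2)) := by
      have h3 : T ≤ 2 * (T / 2) + 1 := by omega
      have h3' : (T : ℝ) ≤ 2 * (T / 2 : ℕ) + 1 := by exact_mod_cast h3
      have h4 : (1 : ℝ) ≤ (T / 2 : ℕ) := by exact_mod_cast h0
      have h5 : (0 : ℝ) ≤ T := Nat.cast_nonneg T
      nlinarith
    have := mul_le_mul_of_nonneg_right h2 hv
    linarith

theorem halfHalf_fgd_gd_hasGradientRate :
    HasGradientRate (halfHalf (fgd (E := E)) gd) 64 3 := by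
  refine ⟨halfHalf_cost_le (fun L T w g => (fgdLoop_cost L g T w w 1).le)
    (fun L T w g => (gdLoop_cost L g T w).le), ?_⟩
  intro L f hL hc hs ws hw w T hT
  rw [halfHalf, GradientProgram.eval_andThen]
  have h1 := fgd_half_value_le hL hs hc hw w hT
  set v := (fgd L (T / 2) w).eval (∇ f)
  have h2 := gdLoop_value hL hs hc hw (T - T / 2) 0 v le_rfl
  change ‖∇ f ((gdLoop L (T - T / 2) v).eval (∇ f))‖ ^ 2 ≤ _
  set r := ‖∇ f ((gdLoop L (T - T / 2) v).eval (∇ f))‖ ^ 2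
  have hr : 0 ≤ r := by positivity
  have hT0 : (0 : ℝ) < T := by exact_mod_cast hT
  rw [show ((T : ℝ)) ^ (3 : ℝ) = (T : ℝ) ^ 3 by norm_cast, le_div_iff₀ (by positivity)]
  have h3 : (T : ℝ) / 2 ≤ (T - T / 2 : ℕ) + 1 := by
    have : T ≤ 2 * ((T - T / 2) + 1) := by omega
    have : (T : ℝ) ≤ 2 * ((T - T / 2 : ℕ) + 1) := by exact_mod_cast this
    linarith
  have h4 : (T : ℝ) / 2 / (2 * L) * r ≤ f v - f ws := by
    refine le_trans ?_ (by simpa using h2)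
    refine mul_le_mul_of_nonneg_right ?_ hr
    gcongr
  have h5 := mul_le_mul_of_nonneg_left h4 (by positivity : (0 : ℝ) ≤ T ^ 2 * (4 * L))
  have h6 : (T : ℝ) ^ 2 * (4 * L) * (T / 2 / (2 * L) * r) = r * T ^ 3 := by
    field_simp; ring
  have h7 := mul_le_mul_of_nonneg_left h1 hL.le
  have h8 := sq_nonneg (L * ‖w - ws‖)
  nlinarith

/-! ### The Kim--Fessler method -/

theorem fsfomBase_ge (j : ℕ) : 1 + (j : ℝ) / 2 ≤ fsfomBase j := by
  induction j with
  | zero => simp [fsfomBase]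
  | succ j ih =>
    have := nesterov_ge (fsfomBase j)
    rw [fsfomBase]
    push_cast
    linarith

theorem fsfomBase_one_le (j : ℕ) : 1 ≤ fsfomBase j := by
  have := fsfomBase_ge j
  have : (0 : ℝ) ≤ j := Nat.cast_nonneg j
  linarith

/-- The energy that decreases along the Kim--Fessler method with final point `X`. -/
noncomputable def fsfomEnergy (L : ℝ) (f : E → ℝ) (X : E) (a : ℝ) (x y : E) : ℝ :=
  1 / a ^ 2 * (1 / (2 * L) * ‖∇ f X‖ ^ 2 + 1 / (2 * L) * ‖∇ f x‖ ^ 2 + f x - f X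
      - ⟪∇ f x, x - y⟫_ℝ)
    + L / a ^ 4 * ⟪(a ^ 2 / (2 * a - 1)) • (x - y),
        y + (a ^ 2 / (2 * a - 1)) • (x - y) - X + (1 / L) • ∇ f X⟫_ℝ

end AcceleratedMethods

/-! ### Rate of the Kim--Fessler method. -/

section KimFessler

/-- The identity behind the first step of the Kim--Fessler method. -/
theorem fsfom_first_identity {E : Type*} [NormedAddCommGroup E] [InnerProductSpace ℝ E]
    (L a q c fx fh fX : ℝ) (hL : L ≠ 0) (ha : a ≠ 0) (ha1 : a - 1 ≠ 0)
    (hq : q = a * (a - 1) / 2) (g h m w : E) :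
    1 / q * (1 / (2 * L) * ‖m‖ ^ 2 + 1 / (2 * L) * ‖h‖ ^ 2 + fh - fX
        - ⟪h, c • (-((a - 1) / (2 * L)) • g)⟫_ℝ)
      + L / q ^ 2 * ⟪-((a - 1) / (2 * L)) • g,
          -w + (1 / L) • m - ((a + 1) / (2 * L)) • g⟫_ℝ
    = 2 / a ^ 2 * (1 / (2 * L) * ‖m‖ ^ 2 + fx - fX)
      - 1 / q * (fx - fh - ⟪h, (1 / L) • g - c • (-((a - 1) / (2 * L)) • g)⟫_ℝ
          - 1 / (2 * L) * ‖g - h‖ ^ 2)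
      - (1 / q - 2 / a ^ 2) * (fX - fx - ⟪g, w⟫_ℝ - 1 / (2 * L) * ‖m - g‖ ^ 2) := by
  subst hq
  simp only [← real_inner_self_eq_norm_sq, inner_add_right, inner_sub_left, inner_neg_right,
    inner_sub_right, real_inner_smul_left, real_inner_smul_right,
    real_inner_comm g h, real_inner_comm m g, real_inner_comm w g]
  field_simp
  ring

variable {E : Type*} [NormedAddCommGroup E] [InnerProductSpace ℝ E] [CompleteSpace E]
variable {L : ℝ} {f : E → ℝ}

/-- `X` is arbitrary here. It will be the output of the whole loop, which is the same from every
intermediate state, so the energy may refer to it in advance. -/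
theorem fsfomEnergy_step (hL : 0 < L) (hs : IsSmoothWith L f) (hc : ConvexOn ℝ Set.univ f)
    (X x y : E) {a b : ℝ} (hb : 1 ≤ b) (ha : 1 < a) (hab : a ^ 2 - a = b ^ 2) :
    fsfomEnergy L f X b
      (x - (1 / L) • ∇ f x + ((a - 1) * (2 * b - 1) / (a * (2 * a - 1))) •
          (x - (1 / L) • ∇ f x - y) + ((2 * b - 1) / (2 * a - 1)) • (x - (1 / L) • ∇ f x - x))
      (x - (1 / L) • ∇ f x) ≤ fsfomEnergy L f X a x y := by
  have ha0 : a ≠ 0 := by linarith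
  have ha1 : a - 1 ≠ 0 := by linarith
  have h2a : 2 * a - 1 ≠ 0 := by linarith
  have h2b : 2 * b - 1 ≠ 0 := by linarith
  have h2a' : a * 2 - 1 ≠ 0 := by linarith
  have h2b' : b * 2 - 1 ≠ 0 := by linarith
  have hb0 : b ≠ 0 := by linarith
  set g := ∇ f x with hg
  set x' := x - (1 / L) • g + ((a - 1) * (2 * b - 1) / (a * (2 * a - 1))) •
          (x - (1 / L) • g - y) + ((2 * b - 1) / (2 * a - 1)) • (x - (1 / L) • g - x) with hx'
  set r := (a ^ 2 / (2 * a - 1)) • (x - y) with hr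
  set c := (2 * b - 1) / b ^ 2 with hcdef
  set r' := ((a - 1) ^ 2 / a ^ 2) • r - ((a - 1) / L) • g with hr'
  have exy : x - y = ((2 * a - 1) / a ^ 2) • r := by
    rw [hr, smul_smul]
    have : (2 * a - 1) / a ^ 2 * (a ^ 2 / (2 * a - 1)) = 1 := by field_simp
    rw [this, one_smul]
  clear_value r
  have ex' : x' - (x - (1 / L) • g) = c • r' := by
    have e1 : x' - (x - (1 / L) • g)
        = ((a - 1) * (2 * b - 1) / (a * (2 * a - 1))) • (x - y)
          - (((a - 1) * (2 * b - 1) / (a * (2 * a - 1)) + (2 * b - 1) / (2 * a - 1)) * (1 / L))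
            • g := by
      rw [hx']; module
    rw [e1, exy, hr', smul_sub, smul_smul, smul_smul, smul_smul]
    have e2 : (a - 1) * (2 * b - 1) / (a * (2 * a - 1)) * ((2 * a - 1) / a ^ 2)
        = c * ((a - 1) ^ 2 / a ^ 2) := by
      rw [hcdef, ← hab]
      have : a ^ 2 - a = a * (a - 1) := by ring
      rw [this]; field_simp
    have e3 : ((a - 1) * (2 * b - 1) / (a * (2 * a - 1)) + (2 * b - 1) / (2 * a - 1)) * (1 / L)
        = c * ((a - 1) / L) := by
      rw [hcdef, ← hab]
      have : a ^ 2 - a = a * (a - 1) := by ring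
      rw [this]; field_simp; ring
    rw [e2, e3]
  have er' : (b ^ 2 / (2 * b - 1)) • (x' - (x - (1 / L) • g)) = r' := by
    rw [ex', smul_smul]
    have : b ^ 2 / (2 * b - 1) * c = 1 := by rw [hcdef]; field_simp
    rw [this, one_smul]
  have ec : (a - 1) ^ 2 / a ^ 2 = 1 - (2 * a - 1) / a ^ 2 := by field_simp; ring
  have es : y + r - X + (1 / L) • ∇ f X
      = ((a - 1) ^ 2 / a ^ 2) • r - (X - x) + (1 / L) • ∇ f X := by
    have : y = x - ((2 * a - 1) / a ^ 2) • r := by rw [← exy]; abel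
    rw [this, ec]; module
  have es' : x - (1 / L) • g + r' - X + (1 / L) • ∇ f X
      = ((a - 1) ^ 2 / a ^ 2) • r - (X - x) + (1 / L) • ∇ f X - (a / L) • g := by
    rw [hr']
    have : (a / L) • g = ((a - 1) / L) • g + (1 / L) • g := by
      rw [← add_smul]; congr 1; ring
    rw [this]; abel
  have exx : x - x' = (1 / L) • g - c • r' := by rw [← ex']; abel
  have Q1 := hs.interpolation hL hc x' x
  have Q2 := hs.interpolation hL hc x X
  rw [exx] at Q1
  have hq : b ^ 2 = a * (a - 1) := by rw [← hab]; ring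
  have key := fsfom_identity L a (b ^ 2) c (f x) (f x') (f X) hL.ne' ha0 ha1 hq r g (∇ f x')
    (∇ f X) (X - x)
  rw [← hr'] at key
  have hw1 : 0 ≤ 1 / b ^ 2 := by positivity
  have hw2 : 0 ≤ 1 / b ^ 2 - 1 / a ^ 2 := by
    rw [sub_nonneg]
    apply one_div_le_one_div_of_le (by positivity)
    linarith
  unfold fsfomEnergy
  rw [← hr, er', ex', es, es', exy]
  have hb4 : b ^ 4 = (b ^ 2) ^ 2 := by ring
  rw [hb4, key, ← hg]
  have p1 := mul_nonneg hw1 (sub_nonneg.2 Q1)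
  have p2 := mul_nonneg hw2 (sub_nonneg.2 Q2)
  linarith

/-- The coefficient `θ_0` obeys a different recursion, with `2b²` in place of `b²`, and `y_0 = x_0`.
This produces the factor `2/a²` in front of the initial value gap. -/
theorem fsfomEnergy_first_step (hL : 0 < L) (hs : IsSmoothWith L f)
    (hc : ConvexOn ℝ Set.univ f) (X x : E) {a b : ℝ} (hb : 1 ≤ b) (ha : 1 < a)
    (hab : a ^ 2 - a = 2 * b ^ 2) :
    fsfomEnergy L f X b
      (x - (1 / L) • ∇ f x + ((a - 1) * (2 * b - 1) / (a * (2 * a - 1))) •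
          (x - (1 / L) • ∇ f x - x) + ((2 * b - 1) / (2 * a - 1)) • (x - (1 / L) • ∇ f x - x))
      (x - (1 / L) • ∇ f x)
      ≤ 2 / a ^ 2 * (1 / (2 * L) * ‖∇ f X‖ ^ 2 + f x - f X) := by
  have ha0 : a ≠ 0 := by linarith
  have ha1 : a - 1 ≠ 0 := by linarith
  have h2a : 2 * a - 1 ≠ 0 := by linarith
  have h2b : 2 * b - 1 ≠ 0 := by linarith
  have h2a' : a * 2 - 1 ≠ 0 := by linarith
  have h2b' : b * 2 - 1 ≠ 0 := by linarith
  have hb0 : b ≠ 0 := by linarith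
  set g := ∇ f x with hg
  set x' := x - (1 / L) • g + ((a - 1) * (2 * b - 1) / (a * (2 * a - 1))) •
          (x - (1 / L) • g - x) + ((2 * b - 1) / (2 * a - 1)) • (x - (1 / L) • g - x) with hx'
  set c := (2 * b - 1) / b ^ 2 with hcdef
  set r' := -((a - 1) / (2 * L)) • g with hr'
  have hq : b ^ 2 = a * (a - 1) / 2 := by linarith
  have ex' : x' - (x - (1 / L) • g) = c • r' := by
    have e1 : x' - (x - (1 / L) • g)
        = -(((a - 1) * (2 * b - 1) / (a * (2 * a - 1)) + (2 * b - 1) / (2 * a - 1)) * (1 / L))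
            • g := by
      rw [hx']; module
    rw [e1, hr', smul_smul]
    congr 1
    rw [hcdef, hq]
    field_simp
    ring
  have er' : (b ^ 2 / (2 * b - 1)) • (x' - (x - (1 / L) • g)) = r' := by
    rw [ex', smul_smul]
    have : b ^ 2 / (2 * b - 1) * c = 1 := by rw [hcdef]; field_simp
    rw [this, one_smul]
  have es' : x - (1 / L) • g + r' - X + (1 / L) • ∇ f X
      = -(X - x) + (1 / L) • ∇ f X - ((a + 1) / (2 * L)) • g := by
    rw [hr']
    have : ((a + 1) / (2 * L)) • g = ((a - 1) / (2 * L)) • g + (1 / L) • g := by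
      rw [← add_smul]; congr 1; field_simp; ring
    rw [this, neg_smul]; abel
  have exx : x - x' = (1 / L) • g - c • r' := by rw [← ex']; abel
  have Q1 := hs.interpolation hL hc x' x
  have Q2 := hs.interpolation hL hc x X
  rw [exx] at Q1
  have key := fsfom_first_identity L a (b ^ 2) c (f x) (f x') (f X) hL.ne' ha0 ha1 hq g (∇ f x')
    (∇ f X) (X - x)
  rw [← hr'] at key
  have hw1 : 0 ≤ 1 / b ^ 2 := by positivity
  have hw2 : 0 ≤ 1 / b ^ 2 - 2 / a ^ 2 := by
    rw [sub_nonneg, div_le_div_iff₀ (by positivity) (by positivity)]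
    linarith
  unfold fsfomEnergy
  rw [er', ex', es']
  have hb4 : b ^ 4 = (b ^ 2) ^ 2 := by ring
  rw [hb4, key]
  have p1 := mul_nonneg hw1 (sub_nonneg.2 Q1)
  have p2 := mul_nonneg hw2 (sub_nonneg.2 Q2)
  linarith

theorem fsfomLoop_energy (hL : 0 < L) (hs : IsSmoothWith L f) (hc : ConvexOn ℝ Set.univ f)
    (N n : ℕ) (hn : n < N) : ∀ x y : E,
      1 / L * ‖∇ f ((fsfomLoop L N n x y).eval (∇ f))‖ ^ 2
        ≤ fsfomEnergy L f ((fsfomLoop L N n x y).eval (∇ f)) (fsfomBase n) x y := by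
  induction n with
  | zero =>
    intro x y
    simp only [fsfomLoop, GradientProgram.eval, fsfomEnergy, fsfomBase]
    -- The current point is now the final one and its coefficient is `1`, so the two inner products
    -- cancel and the claim is an equality.
    have e : y + (x - y) - x + (1 / L) • ∇ f x = (1 / L) • ∇ f x := by abel
    norm_num only
    rw [one_smul, e, real_inner_smul_right, real_inner_comm]
    apply le_of_eq
    field_simp
    ring
  | succ n ih =>
    intro x y
    have h1 : fsfomTheta N (n + 1) = fsfomBase (n + 1) := if_neg (by omega)
    have h2 : fsfomTheta N n = fsfomBase n := if_neg (by omega)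
    simp only [fsfomLoop, GradientProgram.eval]
    refine (ih (by omega) _ _).trans ?_
    rw [h1, h2]
    have h3 := nesterov_ge (fsfomBase n)
    have h4 := fsfomBase_one_le n
    refine fsfomEnergy_step hL hs hc _ x y h4 ?_ (nesterov_sq_sub (fsfomBase n))
    rw [fsfomBase]
    linarith

theorem fsfom_value (hL : 0 < L) (hs : IsSmoothWith L f) (hc : ConvexOn ℝ Set.univ f)
    {ws : E} (hw : IsMinOn f Set.univ ws) (x : E) {N : ℕ} (hN : 1 ≤ N) :
    ((N : ℝ) + 1) ^ 2 * ‖∇ f ((fsfom L N x).eval (∇ f))‖ ^ 2 ≤ 4 * L * (f x - f ws) := by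
  obtain ⟨n, rfl⟩ : ∃ n, N = n + 1 := ⟨N - 1, by omega⟩
  have h1 := fsfomLoop_energy hL hs hc (n + 1) n (Nat.lt_succ_self n)
  set a := fsfomTheta (n + 1) (n + 1) with ha
  have ha' : a = (1 + √(1 + 8 * (fsfomBase n) ^ 2)) / 2 := by
    rw [ha, fsfomTheta, if_pos rfl, Nat.add_sub_cancel]
  have hb := fsfomBase_ge n
  have hb1 := fsfomBase_one_le n
  set b := fsfomBase n with hbdef
  have hsq := Real.sq_sqrt (by positivity : (0 : ℝ) ≤ 1 + 8 * b ^ 2)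
  have hab : a ^ 2 - a = 2 * b ^ 2 := by rw [ha']; nlinarith
  have ha1 : 1 < a := by
    have : 1 < √(1 + 8 * b ^ 2) := Real.lt_sqrt_of_sq_lt (by nlinarith)
    rw [ha']; linarith
  have h2 : fsfomTheta (n + 1) n = b := if_neg (by omega)
  have h3 := fsfomEnergy_first_step hL hs hc ((fsfom L (n + 1) x).eval (∇ f)) x hb1 ha1 hab
  have h4 := h1 (x - (1 / L) • ∇ f x + ((a - 1) * (2 * b - 1) / (a * (2 * a - 1))) •
          (x - (1 / L) • ∇ f x - x) + ((2 * b - 1) / (2 * a - 1)) • (x - (1 / L) • ∇ f x - x))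
      (x - (1 / L) • ∇ f x)
  have e : (fsfom L (n + 1) x).eval (∇ f) = (fsfomLoop L (n + 1) n
      (x - (1 / L) • ∇ f x + ((a - 1) * (2 * b - 1) / (a * (2 * a - 1))) •
          (x - (1 / L) • ∇ f x - x) + ((2 * b - 1) / (2 * a - 1)) • (x - (1 / L) • ∇ f x - x))
      (x - (1 / L) • ∇ f x)).eval (∇ f) := by
    rw [← h2, ha]; rfl
  rw [← e] at h4
  set X := (fsfom L (n + 1) x).eval (∇ f)
  have h5 := hs.norm_gradient_sq_le hL hc hw X
  -- The squared gradient at `X` on the right of the first-step bound is absorbed by passing from `f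
  -- X` to `f ws`.
  have h6 : 1 / L * ‖∇ f X‖ ^ 2 ≤ 2 / a ^ 2 * (f x - f ws) := by
    refine (h4.trans h3).trans (mul_le_mul_of_nonneg_left ?_ (by positivity))
    linarith
  rw [div_mul_eq_mul_div, div_mul_eq_mul_div, div_le_div_iff₀ hL (by positivity)] at h6
  -- `2a² = 2a + 4b²`, and `2b ≥ n + 2`.
  have h7 : ((n + 1 : ℕ) + 1 : ℝ) ^ 2 ≤ 2 * a ^ 2 := by
    have : (2 + (n : ℝ)) ^ 2 ≤ (2 * b) ^ 2 := by gcongr; linarith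
    push_cast
    linarith
  have h8 := mul_le_mul_of_nonneg_right h7 (sq_nonneg ‖∇ f X‖)
  linarith

theorem halfHalf_fgd_fsfom_hasGradientRate :
    HasGradientRate (halfHalf (fgd (E := E)) fsfom) 256 4 := by
  refine ⟨halfHalf_cost_le (fun L T w g => (fgdLoop_cost L g T w w 1).le)
    (fun L T w g => (fsfomLoop_cost L T g T w w).le), ?_⟩
  intro L f hL hc hs ws hw w T hT
  rw [halfHalf, GradientProgram.eval_andThen]
  have h1 := fgd_half_value_le hL hs hc hw w hT
  set v := (fgd L (T / 2) w).eval (∇ f)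
  have h2 := fsfom_value hL hs hc hw v (N := T - T / 2) (by omega)
  set r := ‖∇ f ((fsfom L (T - T / 2) v).eval (∇ f))‖ ^ 2
  have hr : 0 ≤ r := by positivity
  have hT0 : (0 : ℝ) < T := by exact_mod_cast hT
  rw [show ((T : ℝ)) ^ (4 : ℝ) = (T : ℝ) ^ 4 by norm_cast, le_div_iff₀ (by positivity)]
  have h3 : (T : ℝ) / 2 ≤ (T - T / 2 : ℕ) + 1 := by
    have : T ≤ 2 * ((T - T / 2) + 1) := by omega
    have : (T : ℝ) ≤ 2 * ((T - T / 2 : ℕ) + 1) := by exact_mod_cast this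
    linarith
  have h4 : ((T : ℝ) / 2) ^ 2 * r ≤ 4 * L * (f v - f ws) := by
    refine le_trans ?_ h2
    gcongr
  have h5 := mul_le_mul_of_nonneg_left h4 (by positivity : (0 : ℝ) ≤ 4 * T ^ 2)
  have h7 := mul_le_mul_of_nonneg_left h1 (by linarith : 0 ≤ 16 * L)
  have h8 := sq_nonneg (L * ‖w - ws‖)
  nlinarith

end KimFessler

/-! ### Proximal points and conjugates of extended-valued convex functions. -/

section ConvexAnalysis

variable {E : Type*} [NormedAddCommGroup E] [InnerProductSpace ℝ E] {F : E → EReal}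

theorem IsProperClosedConvex.coe_toReal (hF : IsProperClosedConvex F) {z : E} (hz : F z ≠ ⊤) :
    ((F z).toReal : EReal) = F z := EReal.coe_toReal hz (hF.ne_bot z)

theorem IsProperClosedConvex.le_combo (hF : IsProperClosedConvex F) {u v : E} {r s t : ℝ}
    (hu : F u ≤ r) (hv : F v ≤ s) (h0 : 0 ≤ t) (h1 : t ≤ 1) :
    F (u + t • (v - u)) ≤ ((r + t * (s - r) : ℝ) : EReal) := by
  have h : ((1 - t) • ((u, r) : E × ℝ) + t • ((v, s) : E × ℝ))
      ∈ {p : E × ℝ | F p.1 ≤ (p.2 : EReal)} :=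
    hF.convex hu hv (sub_nonneg.2 h1) h0 (by ring)
  have e1 : (1 - t) • u + t • v = u + t • (v - u) := by module
  have e2 : (1 - t) * r + t * s = r + t * (s - r) := by ring
  simpa [e1, e2] using h

/-- No separation theorem is needed: if `m` is the minimum over the unit ball around `z₀`, convexity
along the segment to a far point `z`, tested at distance `1` from `z₀`, bounds `F z` below by a
function linear in `‖z - z₀‖`. -/
theorem IsProperClosedConvex.exists_lower_bound [FiniteDimensional ℝ E]
    (hF : IsProperClosedConvex F) {z₀ : E} (hz : F z₀ ≠ ⊤) :
    ∃ a b : ℝ, 0 ≤ b ∧ ∀ z, ((a - b * ‖z - z₀‖ : ℝ) : EReal) ≤ F z := by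
  obtain ⟨p, hp, hmin⟩ := (hF.closed.lowerSemicontinuousOn _).exists_isMinOn
    (Metric.nonempty_closedBall.2 zero_le_one : (Metric.closedBall z₀ 1).Nonempty)
    (isCompact_closedBall z₀ 1)
  have hpz : F p ≤ F z₀ := hmin (Metric.mem_closedBall_self zero_le_one)
  have hpt : F p ≠ ⊤ := fun h => hz (top_le_iff.1 (h ▸ hpz))
  set m := (F p).toReal with hm
  set r₀ := (F z₀).toReal with hr₀
  have em : (m : EReal) = F p := hF.coe_toReal hpt
  have er₀ : (r₀ : EReal) = F z₀ := hF.coe_toReal hz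
  have hmr : m ≤ r₀ := by
    rw [← em, ← er₀] at hpz
    exact_mod_cast hpz
  refine ⟨m, r₀ - m, sub_nonneg.2 hmr, fun z => ?_⟩
  by_cases hzt : F z = ⊤
  · rw [hzt]; exact le_top
  set r := (F z).toReal with hr
  have er : (r : EReal) = F z := hF.coe_toReal hzt
  rw [← er, EReal.coe_le_coe_iff]
  have hn := norm_nonneg (z - z₀)
  rcases le_or_gt ‖z - z₀‖ 1 with h1 | h1
  · have : F p ≤ F z := hmin (mem_closedBall_iff_norm.2 h1)
    rw [← em, ← er, EReal.coe_le_coe_iff] at this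
    nlinarith
  · have hinv : ‖z - z₀‖⁻¹ ≤ 1 := inv_le_one_of_one_le₀ h1.le
    have h2 := hF.le_combo er₀.ge er.ge (inv_nonneg.2 hn) hinv
    have hmem : z₀ + ‖z - z₀‖⁻¹ • (z - z₀) ∈ Metric.closedBall z₀ 1 := by
      rw [mem_closedBall_iff_norm, add_sub_cancel_left, norm_smul, norm_inv, norm_norm,
        inv_mul_cancel₀ (by linarith)]
    have h3 : (m : EReal) ≤ _ := em.le.trans ((hmin hmem).trans h2)
    rw [EReal.coe_le_coe_iff] at h3
    have h4 := mul_le_mul_of_nonneg_left h3 hn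
    have h5 : ‖z - z₀‖ * (r₀ + ‖z - z₀‖⁻¹ * (r - r₀)) = ‖z - z₀‖ * r₀ + (r - r₀) := by
      field_simp
    nlinarith

theorem IsProperClosedConvex.exists_prox [FiniteDimensional ℝ E]
    (hF : IsProperClosedConvex F) (c : E) {η : ℝ} (hη : 0 < η) :
    ∃ p, F p ≠ ⊤ ∧ ∀ z, F p + ((η / 2 * ‖p - c‖ ^ 2 : ℝ) : EReal)
      ≤ F z + ((η / 2 * ‖z - c‖ ^ 2 : ℝ) : EReal) := by
  obtain ⟨z₀, hz₀⟩ := hF.exists_ne_top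
  obtain ⟨a, b, hb, hlow⟩ := hF.exists_lower_bound hz₀
  set r₀ := (F z₀).toReal with hr₀
  have er₀ : (r₀ : EReal) = F z₀ := hF.coe_toReal hz₀
  set δ := ‖z₀ - c‖ with hδ
  have hδ0 : 0 ≤ δ := norm_nonneg _
  -- Outside this radius the quadratic term beats the linear lower bound, so a minimizer over the
  -- ball is global.
  set R := 2 / η * (b + η * δ + |r₀ - a| + 1) + 1 with hR
  have hR0 : 1 ≤ R := by
    have : 0 ≤ 2 / η * (b + η * δ + |r₀ - a| + 1) := by positivity
    linarith
  have hlsc : LowerSemicontinuous fun z => F z + ((η / 2 * ‖z - c‖ ^ 2 : ℝ) : EReal) := by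
    refine hF.closed.add' (Continuous.lowerSemicontinuous ?_) fun z => ?_
    · exact continuous_coe_real_ereal.comp (by fun_prop)
    · exact EReal.continuousAt_add (Or.inr (EReal.coe_ne_bot _)) (Or.inr (EReal.coe_ne_top _))
  obtain ⟨p, hp, hmin⟩ := (hlsc.lowerSemicontinuousOn _).exists_isMinOn
    (Metric.nonempty_closedBall.2 (by linarith) : (Metric.closedBall z₀ R).Nonempty)
    (isCompact_closedBall z₀ R)
  have hpz : F p + ((η / 2 * ‖p - c‖ ^ 2 : ℝ) : EReal)
      ≤ F z₀ + ((η / 2 * ‖z₀ - c‖ ^ 2 : ℝ) : EReal) :=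
    hmin (Metric.mem_closedBall_self (by linarith))
  refine ⟨p, fun h => ?_, fun z => ?_⟩
  · rw [h, EReal.top_add_coe, ← er₀, ← EReal.coe_add] at hpz
    exact EReal.coe_ne_top _ (top_le_iff.1 hpz)
  · by_cases hz : z ∈ Metric.closedBall z₀ R
    · exact hmin hz
    · refine hpz.trans ?_
      rw [mem_closedBall_iff_norm, not_le] at hz
      refine le_trans ?_ (add_le_add_left (hlow z) _)
      rw [← er₀, ← EReal.coe_add, ← EReal.coe_add, EReal.coe_le_coe_iff, ← hδ]
      set ρ := ‖z - z₀‖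
      have h1 : ρ - δ ≤ ‖z - c‖ := by
        have h := norm_sub_le (z - c) (z₀ - c)
        rw [sub_sub_sub_cancel_right] at h
        linarith
      have h2 : ρ ^ 2 - 2 * ρ * δ + δ ^ 2 ≤ ‖z - c‖ ^ 2 := by
        rcases le_or_gt δ ρ with h | h
        · nlinarith [norm_nonneg (z - c)]
        · exfalso
          have : 2 * δ ≤ 2 / η * (b + η * δ + |r₀ - a| + 1) := by
            rw [div_mul_eq_mul_div, le_div_iff₀ hη]
            nlinarith [abs_nonneg (r₀ - a)]
          linarith
      have h3 : b + η * δ + |r₀ - a| + 1 ≤ η / 2 * ρ := by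
        have : 2 / η * (b + η * δ + |r₀ - a| + 1) ≤ ρ := by linarith
        rw [div_mul_eq_mul_div, div_le_iff₀ hη] at this
        linarith
      have h4 : (|r₀ - a| + 1) ≤ ρ * (η / 2 * ρ - b - η * δ) := by
        have : (1 : ℝ) ≤ ρ := by linarith
        nlinarith [abs_nonneg (r₀ - a)]
      have h5 := le_abs_self (r₀ - a)
      have h6 := mul_le_mul_of_nonneg_left h2 (by positivity : 0 ≤ η / 2)
      nlinarith

theorem IsProperClosedConvex.prox_mem_subdifferential (hF : IsProperClosedConvex F)
    {c p : E} {η : ℝ} (hη : 0 < η) (hp : F p ≠ ⊤)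
    (hmin : ∀ z, F p + ((η / 2 * ‖p - c‖ ^ 2 : ℝ) : EReal)
      ≤ F z + ((η / 2 * ‖z - c‖ ^ 2 : ℝ) : EReal)) :
    η • (c - p) ∈ subdifferential F p := by
  intro z
  by_cases hz : F z = ⊤
  · rw [hz]; exact le_top
  have ep := hF.coe_toReal hp
  have ez := hF.coe_toReal hz
  set s := (F p).toReal
  set r := (F z).toReal
  rw [← ep, ← ez, ← EReal.coe_add, EReal.coe_le_coe_iff, real_inner_smul_left]
  -- The minimizer is compared with points of the segment towards `z`, and `t` is divided out. In
  -- place of a limit, `t = X / (X + k + 1)` below contradicts `0 < X ≤ t k`.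
  have key : ∀ t : ℝ, 0 < t → t ≤ 1 →
      s - r + η * ⟪c - p, z - p⟫_ℝ ≤ t * (η / 2 * ‖z - p‖ ^ 2) := by
    intro t ht ht1
    have h1 := hF.le_combo ep.ge ez.ge ht.le ht1
    have h2 := (hmin (p + t • (z - p))).trans (add_le_add_left h1 _)
    rw [← ep, ← EReal.coe_add, ← EReal.coe_add, EReal.coe_le_coe_iff] at h2
    have e : p + t • (z - p) - c = t • (z - p) - (c - p) := by abel
    rw [e, norm_sub_sq_real (t • (z - p)), norm_smul, mul_pow, Real.norm_eq_abs, sq_abs,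
      real_inner_smul_left, real_inner_comm, norm_sub_rev c p] at h2
    refine le_of_mul_le_mul_left ?_ ht
    linarith
  by_contra! hcon
  set X := s - r + η * ⟪c - p, z - p⟫_ℝ with hX
  have hX0 : 0 < X := by linarith
  set k := η / 2 * ‖z - p‖ ^ 2
  have hk : 0 ≤ k := by positivity
  have := key (X / (X + k + 1)) (by positivity) (by rw [div_le_one (by positivity)]; linarith)
  rw [div_mul_eq_mul_div, le_div_iff₀ (by positivity)] at this
  nlinarith

theorem le_conjugate (F : E → EReal) (y z : E) :
    ((⟪y, z⟫_ℝ : ℝ) : EReal) - F z ≤ conjugate F y :=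
  le_iSup (fun z : E => ((⟪y, z⟫_ℝ : ℝ) : EReal) - F z) z

theorem IsProperClosedConvex.conjugate_ne_bot (hF : IsProperClosedConvex F) (y : E) :
    conjugate F y ≠ ⊥ := by
  obtain ⟨z, hz⟩ := hF.exists_ne_top
  have h := le_conjugate F y z
  rw [← hF.coe_toReal hz, ← EReal.coe_sub] at h
  intro hb
  rw [hb] at h
  exact EReal.coe_ne_bot _ (le_bot_iff.1 h)

theorem IsProperClosedConvex.mem_subdifferential_conjugate (hF : IsProperClosedConvex F)
    {p y : E} (hp : F p ≠ ⊤) (hy : y ∈ subdifferential F p) :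
    p ∈ subdifferential (conjugate F) y := by
  have ep := hF.coe_toReal hp
  set s := (F p).toReal
  intro z
  have h1 : conjugate F y ≤ ((⟪y, p⟫_ℝ - s : ℝ) : EReal) := by
    refine iSup_le fun u => ?_
    by_cases hu : F u = ⊤
    · rw [hu, EReal.sub_top]; exact bot_le
    have h := hy u
    rw [← ep, ← hF.coe_toReal hu, ← EReal.coe_add, EReal.coe_le_coe_iff, inner_sub_right] at h
    rw [← hF.coe_toReal hu, ← EReal.coe_sub, EReal.coe_le_coe_iff]
    linarith
  refine (add_le_add_left h1 _).trans (le_trans (le_of_eq ?_) (le_conjugate F z p))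
  rw [← ep, ← EReal.coe_add, ← EReal.coe_sub, inner_sub_right, real_inner_comm p z,
    real_inner_comm p y]
  congr 1
  ring

/-- The resolvent of the subdifferential of the conjugate is defined everywhere. -/
theorem IsProperClosedConvex.exists_conjugate_prox [FiniteDimensional ℝ E]
    (hF : IsProperClosedConvex F) (b : E) {η : ℝ} (hη : 0 < η) :
    ∃ y, ∃ g ∈ subdifferential (conjugate F) y, y + η • g = b := by
  -- Moreau's decomposition: if `p` is the proximal point of `F` at `b/η`, then `y = b - η p` lies
  -- in `∂F(p)`, so `p` is a subgradient of the conjugate at `y`.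
  obtain ⟨p, hp, hmin⟩ := hF.exists_prox ((1 / η) • b) hη
  refine ⟨η • ((1 / η) • b - p), p,
    hF.mem_subdifferential_conjugate hp (hF.prox_mem_subdifferential hη hp hmin), ?_⟩
  rw [smul_sub, smul_smul, mul_one_div_cancel hη.ne', one_smul, sub_add_cancel]

/-- The domain of `F` is contained in every closed set that contains the subdifferentials of the
conjugate. -/
theorem IsProperClosedConvex.dom_subset [FiniteDimensional ℝ E]
    (hF : IsProperClosedConvex F) {V : Set E} (hV : IsClosed V)
    (h : ∀ y, subdifferential (conjugate F) y ⊆ V) {z : E} (hz : F z ≠ ⊤) : z ∈ V := by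
  obtain ⟨a, b, hb, hlow⟩ := hF.exists_lower_bound hz
  have ez := hF.coe_toReal hz
  set r := (F z).toReal
  rw [← hV.closure_eq, Metric.mem_closure_iff]
  intro ε hε
  by_contra! hcon
  -- Proximal points of `F` at `z` are subgradients of the conjugate, hence in `V`. This weight is
  -- so large that such a point at distance at least `ε` from `z` would cost more than `F z`.
  set n := 2 * (|r - a| / ε ^ 2 + b / ε) + 1 with hn
  have hn0 : 0 < n := by positivity
  obtain ⟨p, hp, hmin⟩ := hF.exists_prox z hn0
  have hpV := h _ (hF.mem_subdifferential_conjugate hp (hF.prox_mem_subdifferential hn0 hp hmin))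
  have hd := hcon p hpV
  rw [dist_comm, dist_eq_norm] at hd
  have h1 := (add_le_add_left (hlow p) _).trans (hmin z)
  rw [← ez, ← EReal.coe_add, ← EReal.coe_add, EReal.coe_le_coe_iff, sub_self, norm_zero] at h1
  set d := ‖p - z‖
  have hd0 : 0 < d := by linarith
  have h2 : |r - a| ≤ |r - a| / ε ^ 2 * d ^ 2 := by
    rw [div_mul_eq_mul_div, le_div_iff₀ (by positivity)]
    gcongr
  have h3 : b * d ≤ b / ε * d ^ 2 := by
    rw [div_mul_eq_mul_div, le_div_iff₀ (by positivity)]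
    have := mul_le_mul_of_nonneg_left hd (by positivity : 0 ≤ b * d)
    linarith
  have h4 := le_abs_self (r - a)
  have h5 : n / 2 * d ^ 2 = |r - a| / ε ^ 2 * d ^ 2 + b / ε * d ^ 2 + d ^ 2 / 2 := by
    rw [hn]; ring
  have : 0 < d ^ 2 := by positivity
  linarith

theorem conjugate_add_of_orthogonal {V : Set E} (h : ∀ z, F z ≠ ⊤ → z ∈ V) {v : E}
    (hv : ∀ z ∈ V, ⟪v, z⟫_ℝ = 0) (y : E) : conjugate F (y + v) = conjugate F y := by
  refine iSup_congr fun z => ?_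
  by_cases hz : F z = ⊤
  · rw [hz, EReal.sub_top, EReal.sub_top]
  · rw [inner_add_left, hv z (h z hz), add_zero]

end ConvexAnalysis

/-! ### The smallest eigenvalues of `K Kᵀ`. -/

section Spectral

variable {X Y : Type*} [NormedAddCommGroup X] [InnerProductSpace ℝ X] [FiniteDimensional ℝ X]
  [NormedAddCommGroup Y] [InnerProductSpace ℝ Y] [FiniteDimensional ℝ Y]

theorem inner_comp_adjoint (K : X →L[ℝ] Y) (u v : Y) :
    ⟪(K ∘L K.adjoint) u, v⟫_ℝ = ⟪K.adjoint u, K.adjoint v⟫_ℝ := by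
  rw [ContinuousLinearMap.comp_apply, ← ContinuousLinearMap.adjoint_inner_right]

theorem isSymmetric_comp_adjoint (K : X →L[ℝ] Y) :
    ((K ∘L K.adjoint : Y →L[ℝ] Y) : Y →ₗ[ℝ] Y).IsSymmetric := fun u v => by
  change ⟪(K ∘L K.adjoint) u, v⟫_ℝ = ⟪u, (K ∘L K.adjoint) v⟫_ℝ
  rw [inner_comp_adjoint, real_inner_comm, ← inner_comp_adjoint, real_inner_comm]

/-- In an eigenbasis of `K Kᵀ` only positive eigenvalues matter: an eigenvector with eigenvalue `0`
is killed by `Kᵀ` and so is orthogonal to the range of `K`. -/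
theorem lambdaMinPos_mul_norm_sq_le (K : X →L[ℝ] Y) {y : Y} (hy : y ∈ Set.range K) :
    lambdaMinPos (K ∘L K.adjoint) * ‖y‖ ^ 2 ≤ ‖K.adjoint y‖ ^ 2 := by
  have hS := isSymmetric_comp_adjoint K
  set b := hS.eigenvectorBasis rfl
  have hb : ∀ i, (K ∘L K.adjoint) (b i) = hS.eigenvalues rfl i • b i := fun i =>
    hS.apply_eigenvectorBasis rfl i
  have e1 : ‖K.adjoint y‖ ^ 2 = ∑ i, hS.eigenvalues rfl i * ⟪b i, y⟫_ℝ ^ 2 := by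
    rw [← real_inner_self_eq_norm_sq, ← inner_comp_adjoint, ← b.sum_inner_mul_inner]
    refine Finset.sum_congr rfl fun i _ => ?_
    rw [inner_comp_adjoint, real_inner_comm, ← inner_comp_adjoint, hb, real_inner_smul_left]
    ring
  have e2 : ‖y‖ ^ 2 = ∑ i, ⟪b i, y⟫_ℝ ^ 2 := by
    rw [← real_inner_self_eq_norm_sq, ← b.sum_inner_mul_inner]
    refine Finset.sum_congr rfl fun i _ => ?_
    rw [real_inner_comm, sq]
  rw [e1, e2, Finset.mul_sum]
  refine Finset.sum_le_sum fun i _ => ?_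
  have hnorm : ‖K.adjoint (b i)‖ ^ 2 = hS.eigenvalues rfl i := by
    rw [← real_inner_self_eq_norm_sq, ← inner_comp_adjoint, hb, real_inner_smul_left,
      real_inner_self_eq_norm_sq, b.norm_eq_one]
    ring
  rcases (sq_nonneg ‖K.adjoint (b i)‖).eq_or_lt with h | h
  · obtain ⟨x, rfl⟩ := hy
    have h0 : K.adjoint (b i) = 0 := norm_eq_zero.1 (pow_eq_zero_iff two_ne_zero |>.1 h.symm)
    rw [← ContinuousLinearMap.adjoint_inner_left, h0, inner_zero_left]
    simp
  · refine mul_le_mul_of_nonneg_right (csInf_le ⟨0, fun l hl => hl.1.le⟩ ⟨?_, ?_⟩) (sq_nonneg _)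
    · rwa [← hnorm]
    · exact hS.hasEigenvalue_eigenvalues rfl i

/-- A nonzero kernel vector of `Kᵀ` would make `0` an eigenvalue, so `Kᵀ` is injective and the range
of `K` has trivial orthogonal complement. -/
theorem surjective_of_lambdaMin_pos (K : X →L[ℝ] Y) (h : 0 < lambdaMin (K ∘L K.adjoint)) :
    Function.Surjective K := by
  have hker : ∀ y, K.adjoint y = 0 → y = 0 := by
    intro y hy
    by_contra hne
    refine h.not_ge (csInf_le ⟨0, ?_⟩ ?_)
    · intro l hl
      obtain ⟨v, hv⟩ := Module.End.HasEigenvalue.exists_hasEigenvector hl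
      have e1 : (K ∘L K.adjoint) v = l • v := hv.apply_eq_smul
      have e2 : l * ‖v‖ ^ 2 = ‖K.adjoint v‖ ^ 2 := by
        rw [← real_inner_self_eq_norm_sq, ← real_inner_smul_left, ← e1, inner_comp_adjoint,
          real_inner_self_eq_norm_sq]
      have : 0 < ‖v‖ := norm_pos_iff.2 hv.2
      by_contra! hl
      nlinarith [sq_nonneg ‖K.adjoint v‖, mul_pos this this]
    · refine Module.End.hasEigenvalue_of_hasEigenvector (x := y) ⟨?_, hne⟩
      rw [Module.End.mem_eigenspace_iff]
      change K (K.adjoint y) = (0 : ℝ) • y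
      rw [hy, map_zero, zero_smul]
  have hr : (LinearMap.range (K : X →ₗ[ℝ] Y))ᗮ = ⊥ := by
    rw [Submodule.eq_bot_iff]
    intro y hy
    refine hker y (ext_inner_left ℝ fun x => ?_)
    rw [ContinuousLinearMap.adjoint_inner_right, inner_zero_right]
    exact hy (K x) ⟨x, rfl⟩
  rw [Submodule.orthogonal_eq_bot_iff] at hr
  exact LinearMap.range_eq_top.1 hr

end Spectral

/-! ### Consequences of the standing assumptions; existence of solutions and of runs. -/

namespace SaddleProblem

variable {dx dy : ℕ} {P : SaddleProblem dx dy}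

theorem Standing.isSmoothWith (hP : P.Standing) : IsSmoothWith P.LX P.G :=
  ⟨hP.differentiable, hP.smooth⟩

theorem Standing.strong_gradient_inequality (hP : P.Standing) (u v : EuclideanSpace ℝ (Fin dx)) :
    P.G u + ⟪∇ P.G u, v - u⟫_ℝ + P.muX / 2 * ‖v - u‖ ^ 2 ≤ P.G v := by
  have := hP.strongly_convex v u
  linarith

theorem Standing.convexOn (hP : P.Standing) : ConvexOn ℝ Set.univ P.G := by
  refine convexOn_of_gradient_inequality fun u v => ?_
  have h1 := hP.strong_gradient_inequality u v
  have h2 := hP.muX_pos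
  have h3 : 0 ≤ P.muX / 2 * ‖v - u‖ ^ 2 := by positivity
  linarith

theorem Standing.strong_monotone (hP : P.Standing) (u v : EuclideanSpace ℝ (Fin dx)) :
    P.muX * ‖u - v‖ ^ 2 ≤ ⟪∇ P.G u - ∇ P.G v, u - v⟫_ℝ := by
  have h1 := hP.strong_gradient_inequality u v
  have h2 := hP.strong_gradient_inequality v u
  have h3 : ⟪∇ P.G u, v - u⟫_ℝ = -⟪∇ P.G u, u - v⟫_ℝ := by rw [← inner_neg_right, neg_sub]
  rw [norm_sub_rev] at h1
  rw [inner_sub_left]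
  linarith

theorem Standing.muX_le (hP : P.Standing) : P.muX ≤ P.LX := by
  obtain ⟨x, hx⟩ : ∃ x, P.K x ≠ 0 := by
    by_contra! h
    exact hP.K_ne_zero (ContinuousLinearMap.ext h)
  have hx0 : x ≠ 0 := fun h => hx (by rw [h, map_zero])
  have h1 := hP.strong_monotone x 0
  have h2 := hP.smooth x 0
  have h3 := real_inner_le_norm (∇ P.G x - ∇ P.G 0) (x - 0)
  rw [sub_zero] at *
  have h4 : 0 < ‖x‖ := norm_pos_iff.2 hx0
  have h5 := mul_le_mul_of_nonneg_right h2 h4.le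
  refine le_of_mul_le_mul_right ?_ (mul_pos h4 h4)
  linarith

theorem Standing.LX_pos (hP : P.Standing) : 0 < P.LX := hP.muX_pos.trans_le hP.muX_le

theorem Standing.LXY_pos (hP : P.Standing) : 0 < P.LXY := norm_pos_iff.2 hP.K_ne_zero

/-- The two cases of the spectral assumption merge: if the inclusion failed, `λ_min(K Kᵀ)` would be
positive and `K` onto, so the inclusion would hold after all. -/
theorem Standing.subdifferential_subset (hP : P.Standing) (y : EuclideanSpace ℝ (Fin dy)) :
    subdifferential P.Fstar y ⊆ Set.range P.K := by
  by_contra hcon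
  have h := hP.muXY_le_of_not_range fun h => hcon (h y)
  have hs := surjective_of_lambdaMin_pos P.K ((pow_pos hP.muXY_pos 2).trans_le h)
  exact hcon fun z _ => hs z

theorem Standing.muXY_mul_norm_le (hP : P.Standing) {y : EuclideanSpace ℝ (Fin dy)}
    (hy : y ∈ Set.range P.K) : P.muXY ^ 2 * ‖y‖ ^ 2 ≤ ‖P.Kt y‖ ^ 2 :=
  (mul_le_mul_of_nonneg_right (hP.muXY_le_of_range hP.subdifferential_subset)
    (sq_nonneg _)).trans (lambdaMinPos_mul_norm_sq_le P.K hy)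

theorem norm_Kt_le (y : EuclideanSpace ℝ (Fin dy)) : ‖P.Kt y‖ ≤ P.LXY * ‖y‖ := by
  have := P.Kt.le_opNorm y
  rwa [Kt, LinearIsometryEquiv.norm_map] at this

theorem Standing.muXY_le (hP : P.Standing) : P.muXY ≤ P.LXY := by
  obtain ⟨x, hx⟩ : ∃ x, P.K x ≠ 0 := by
    by_contra! h
    exact hP.K_ne_zero (ContinuousLinearMap.ext h)
  have h1 := hP.muXY_mul_norm_le ⟨x, rfl⟩
  have h2 : ‖P.Kt (P.K x)‖ ^ 2 ≤ (P.LXY * ‖P.K x‖) ^ 2 := by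
    gcongr
    exact norm_Kt_le _
  have h3 : 0 < ‖P.K x‖ ^ 2 := pow_pos (norm_pos_iff.2 hx) 2
  rw [mul_pow] at h2
  have h4 : P.muXY ^ 2 ≤ P.LXY ^ 2 := le_of_mul_le_mul_right (h1.trans h2) h3
  exact (sq_le_sq₀ hP.muXY_pos.le hP.LXY_pos.le).1 h4

theorem inner_K (x : EuclideanSpace ℝ (Fin dx)) (y : EuclideanSpace ℝ (Fin dy)) :
    ⟪y, P.K x⟫_ℝ = ⟪P.Kt y, x⟫_ℝ := (ContinuousLinearMap.adjoint_inner_left P.K x y).symm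

theorem Standing.Fstar_ne_bot (hP : P.Standing) (y : EuclideanSpace ℝ (Fin dy)) :
    P.Fstar y ≠ ⊥ := hP.F_convex.conjugate_ne_bot y

/-! ### Solutions -/

theorem hasGradientAt_add_linear {f : EuclideanSpace ℝ (Fin dx) → ℝ}
    {u : EuclideanSpace ℝ (Fin dx)} (hf : DifferentiableAt ℝ f u)
    (v : EuclideanSpace ℝ (Fin dx)) :
    HasGradientAt (fun x => f x + ⟪v, x⟫_ℝ) (∇ f u + v) u := by
  rw [hasGradientAt_iff_hasFDerivAt, map_add]
  exact hf.hasGradientAt.hasFDerivAt.add (InnerProductSpace.toDual ℝ _ v).hasFDerivAt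

theorem IsSolution.gradient_eq (hP : P.Standing) {xs : EuclideanSpace ℝ (Fin dx)}
    {ys : EuclideanSpace ℝ (Fin dy)} (h : P.IsSolution xs ys) : ∇ P.G xs + P.Kt ys = 0 := by
  have hmin : IsMinOn (fun x => P.G x + ⟪P.Kt ys, x⟫_ℝ) Set.univ xs := by
    intro x _
    have h1 := h.min_x x
    unfold lagrangian at h1
    rw [← EReal.coe_toReal h.mem_dom (hP.Fstar_ne_bot ys), ← EReal.coe_sub, ← EReal.coe_sub,
      EReal.coe_le_coe_iff, inner_K, inner_K] at h1
    change P.G xs + ⟪P.Kt ys, xs⟫_ℝ ≤ P.G x + ⟪P.Kt ys, x⟫_ℝ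
    linarith
  rw [← hmin.gradient_eq_zero]
  exact (hasGradientAt_add_linear (hP.differentiable xs) (P.Kt ys)).gradient.symm

theorem IsSolution.mem_subdifferential (hP : P.Standing) {xs : EuclideanSpace ℝ (Fin dx)}
    {ys : EuclideanSpace ℝ (Fin dy)} (h : P.IsSolution xs ys) :
    P.K xs ∈ subdifferential P.Fstar ys := by
  intro y
  by_cases hy : P.Fstar y = ⊤
  · rw [hy]; exact le_top
  have h1 := h.max_y y
  unfold lagrangian at h1
  have e1 := EReal.coe_toReal h.mem_dom (hP.Fstar_ne_bot ys)
  have e2 := EReal.coe_toReal hy (hP.Fstar_ne_bot y)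
  rw [← e1, ← e2, ← EReal.coe_sub, ← EReal.coe_sub, EReal.coe_le_coe_iff] at h1
  rw [← e1, ← e2, ← EReal.coe_add, EReal.coe_le_coe_iff, inner_sub_right, real_inner_comm y,
    real_inner_comm ys]
  linarith

theorem Standing.subgradient_monotone (hP : P.Standing) {y y' g g' : EuclideanSpace ℝ (Fin dy)}
    (hg : g ∈ subdifferential P.Fstar y) (hg' : g' ∈ subdifferential P.Fstar y')
    (hy' : P.Fstar y' ≠ ⊤) : 0 ≤ ⟪g - g', y - y'⟫_ℝ := by
  have h1 := hg y'
  have h2 := hg' y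
  have e1 := EReal.coe_toReal hy' (hP.Fstar_ne_bot y')
  have hy : P.Fstar y ≠ ⊤ := by
    intro h
    rw [h, EReal.top_add_coe] at h1
    exact hy' (top_le_iff.1 h1)
  have e2 := EReal.coe_toReal hy (hP.Fstar_ne_bot y)
  rw [← e1, ← e2, ← EReal.coe_add, EReal.coe_le_coe_iff] at h1 h2
  have h3 : ⟪g, y' - y⟫_ℝ = -⟪g, y - y'⟫_ℝ := by rw [← inner_neg_right, neg_sub]
  rw [inner_sub_left]
  linarith

/-- `dom F` lies in the range of `K`, so a shift orthogonal to that range changes neither `F⋆` nor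
the bilinear term. -/
theorem Standing.isSolution_add_orthogonal (hP : P.Standing) {xs : EuclideanSpace ℝ (Fin dx)}
    {ys v : EuclideanSpace ℝ (Fin dy)} (h : P.IsSolution xs ys)
    (hv : ∀ x, ⟪v, P.K x⟫_ℝ = 0) : P.IsSolution xs (ys + v) := by
  have hcl : IsClosed (Set.range P.K) := by
    have := Submodule.closed_of_finiteDimensional (LinearMap.range
      (P.K : EuclideanSpace ℝ (Fin dx) →ₗ[ℝ] EuclideanSpace ℝ (Fin dy)))
    exact this
  have hF : P.Fstar (ys + v) = P.Fstar ys := by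
    refine conjugate_add_of_orthogonal (V := Set.range P.K)
      (fun z hz => hP.F_convex.dom_subset hcl hP.subdifferential_subset hz) ?_ ys
    rintro _ ⟨x, rfl⟩
    exact hv x
  have hl : ∀ x, P.lagrangian x (ys + v) = P.lagrangian x ys := fun x => by
    rw [lagrangian, lagrangian, hF, inner_add_left, hv, add_zero]
  exact ⟨hF ▸ h.mem_dom, fun x => by rw [hl, hl]; exact h.min_x x,
    fun y => by rw [hl]; exact h.max_y y⟩

theorem Standing.existsUnique_reachable (hP : P.Standing) (y₀ : EuclideanSpace ℝ (Fin dy)) :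
    ∃! z : EuclideanSpace ℝ (Fin dx) × EuclideanSpace ℝ (Fin dy),
      P.IsReachableSolution y₀ z.1 z.2 := by
  obtain ⟨xs, ys, hsol⟩ := hP.solvable
  obtain ⟨u, hu, v, hv, huv⟩ :=
    (LinearMap.range (P.K : EuclideanSpace ℝ (Fin dx) →ₗ[ℝ] _)).exists_add_mem_mem_orthogonal
      (ys - y₀)
  have hv' : ∀ x, ⟪-v, P.K x⟫_ℝ = 0 := fun x => by
    rw [inner_neg_left, real_inner_comm, hv (P.K x) ⟨x, rfl⟩, neg_zero]
  have hsol' := hP.isSolution_add_orthogonal hsol hv'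
  refine ⟨(xs, ys + -v), ⟨hsol', ?_⟩, ?_⟩
  · obtain ⟨x, hx⟩ := hu
    refine ⟨x, ?_⟩
    change P.K x = u at hx
    change P.K x = ys + -v - y₀
    rw [hx, eq_sub_of_add_eq huv.symm]
    abel
  · rintro ⟨x', y'⟩ ⟨h1, h2⟩
    have g1 := IsSolution.gradient_eq hP h1
    have g2 := IsSolution.gradient_eq hP hsol'
    have s1 := IsSolution.mem_subdifferential hP h1
    have s2 := IsSolution.mem_subdifferential hP hsol'
    have m1 := hP.subgradient_monotone s1 s2 hsol'.mem_dom
    have m2 := hP.strong_monotone x' xs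
    have e1 : ∇ P.G x' - ∇ P.G xs = -P.Kt (y' - (ys + -v)) := by
      rw [eq_neg_of_add_eq_zero_left g1, eq_neg_of_add_eq_zero_left g2, map_sub]; abel
    rw [← map_sub, real_inner_comm, inner_K] at m1
    rw [e1, inner_neg_left] at m2
    -- Monotonicity of `∂F⋆` and strong monotonicity of `∇G` bound the same inner product with
    -- opposite signs.
    have hx : x' = xs := by
      have := hP.muX_pos
      have h3 : ‖x' - xs‖ ^ 2 = 0 := by
        refine le_antisymm ?_ (sq_nonneg _)
        by_contra! h
        nlinarith
      exact sub_eq_zero.1 (norm_eq_zero.1 (pow_eq_zero_iff two_ne_zero |>.1 h3))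
    have hy : y' - (ys + -v) ∈ Set.range P.K := by
      obtain ⟨a, ha⟩ := h2
      obtain ⟨c, hc⟩ := hu
      change P.K c = u at hc
      refine ⟨a - c, ?_⟩
      rw [map_sub, ha, hc, eq_sub_of_add_eq huv.symm]
      change y' - y₀ - _ = _
      abel
    have h4 := hP.muXY_mul_norm_le hy
    have h5 : P.Kt (y' - (ys + -v)) = 0 := by
      rw [hx, sub_self] at e1
      exact neg_eq_zero.1 e1.symm
    rw [h5, norm_zero] at h4
    have h6 : ‖y' - (ys + -v)‖ ^ 2 = 0 := by
      refine le_antisymm ?_ (sq_nonneg _)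
      have := pow_pos hP.muXY_pos 2
      by_contra! h
      nlinarith
    rw [hx, sub_eq_zero.1 (norm_eq_zero.1 (pow_eq_zero_iff two_ne_zero |>.1 h6))]

/-! ### The auxiliary problems and the existence of runs -/

theorem Standing.hasGradientAt_auxiliary (hP : P.Standing) (eta : ℝ)
    (x : EuclideanSpace ℝ (Fin dx)) (ybar : EuclideanSpace ℝ (Fin dy))
    (u : EuclideanSpace ℝ (Fin dx)) :
    HasGradientAt (P.auxiliary eta x ybar)
      (∇ P.G u + (1 / eta) • (u - (x - eta • P.Kt ybar))) u := by
  rw [hasGradientAt_iff_hasFDerivAt, map_add]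
  refine (hP.differentiable u).hasGradientAt.hasFDerivAt.add ?_
  have h := (((hasFDerivAt_id u).sub_const (x - eta • P.Kt ybar)).norm_sq).const_mul
    (1 / (2 * eta))
  refine h.congr_fderiv ?_
  ext d
  simp
  ring

theorem Standing.gradient_auxiliary (hP : P.Standing) (eta : ℝ)
    (x : EuclideanSpace ℝ (Fin dx)) (ybar : EuclideanSpace ℝ (Fin dy))
    (u : EuclideanSpace ℝ (Fin dx)) :
    ∇ (P.auxiliary eta x ybar) u = ∇ P.G u + (1 / eta) • (u - (x - eta • P.Kt ybar)) :=
  (hP.hasGradientAt_auxiliary eta x ybar u).gradient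

theorem Standing.gradient_auxiliary_sub (hP : P.Standing) (eta : ℝ)
    (x : EuclideanSpace ℝ (Fin dx)) (ybar : EuclideanSpace ℝ (Fin dy))
    (u v : EuclideanSpace ℝ (Fin dx)) :
    ∇ (P.auxiliary eta x ybar) u - ∇ (P.auxiliary eta x ybar) v
      = (∇ P.G u - ∇ P.G v) + (1 / eta) • (u - v) := by
  rw [hP.gradient_auxiliary, hP.gradient_auxiliary]
  module

theorem Standing.isSmoothWith_auxiliary (hP : P.Standing) {eta : ℝ} (he : 0 < eta)
    (x : EuclideanSpace ℝ (Fin dx)) (ybar : EuclideanSpace ℝ (Fin dy)) :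
    IsSmoothWith (P.LX + 1 / eta) (P.auxiliary eta x ybar) := by
  refine ⟨fun u => (hP.hasGradientAt_auxiliary eta x ybar u).differentiableAt, fun u v => ?_⟩
  rw [hP.gradient_auxiliary_sub, add_mul]
  refine (norm_add_le _ _).trans (add_le_add (hP.smooth u v) ?_)
  rw [norm_smul, Real.norm_of_nonneg (by positivity)]

theorem Standing.auxiliary_gradient_inequality (hP : P.Standing) (eta : ℝ)
    (x : EuclideanSpace ℝ (Fin dx)) (ybar : EuclideanSpace ℝ (Fin dy))
    (u v : EuclideanSpace ℝ (Fin dx)) :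
    P.auxiliary eta x ybar u + ⟪∇ (P.auxiliary eta x ybar) u, v - u⟫_ℝ
      + (P.muX / 2 + 1 / (2 * eta)) * ‖v - u‖ ^ 2 ≤ P.auxiliary eta x ybar v := by
  have h := hP.strong_gradient_inequality u v
  rw [hP.gradient_auxiliary, auxiliary, auxiliary, inner_add_left, real_inner_smul_left]
  set c := x - eta • P.Kt ybar
  have e : v - c = (v - u) + (u - c) := by abel
  rw [e, norm_add_sq_real, real_inner_comm (u - c) (v - u)]
  have : 1 / (2 * eta) * (‖v - u‖ ^ 2 + 2 * ⟪u - c, v - u⟫_ℝ + ‖u - c‖ ^ 2)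
      = 1 / (2 * eta) * ‖v - u‖ ^ 2 + 1 / eta * ⟪u - c, v - u⟫_ℝ
        + 1 / (2 * eta) * ‖u - c‖ ^ 2 := by
    ring
  linarith

theorem Standing.convexOn_auxiliary (hP : P.Standing) {eta : ℝ} (he : 0 < eta)
    (x : EuclideanSpace ℝ (Fin dx)) (ybar : EuclideanSpace ℝ (Fin dy)) :
    ConvexOn ℝ Set.univ (P.auxiliary eta x ybar) := by
  refine convexOn_of_gradient_inequality fun u v => ?_
  have h1 := hP.auxiliary_gradient_inequality eta x ybar u v
  have h2 := hP.muX_pos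
  have h3 : 0 ≤ (P.muX / 2 + 1 / (2 * eta)) * ‖v - u‖ ^ 2 := by positivity
  linarith

theorem Standing.exists_isMinOn_auxiliary (hP : P.Standing) {eta : ℝ} (he : 0 < eta)
    (x : EuclideanSpace ℝ (Fin dx)) (ybar : EuclideanSpace ℝ (Fin dy)) :
    ∃ w, IsMinOn (P.auxiliary eta x ybar) Set.univ w := by
  have hcont : Continuous (P.auxiliary eta x ybar) :=
    (hP.isSmoothWith_auxiliary he x ybar).1.continuous
  set g := ∇ (P.auxiliary eta x ybar) 0
  set c := P.muX / 2 + 1 / (2 * eta)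
  have hc : 0 < c := by
    have := hP.muX_pos
    positivity
  -- Strong convexity makes the function exceed its value at `0` once `c‖v‖ ≥ ‖g‖`, so a minimizer
  -- exists.
  have hev : ∀ᶠ v in Filter.cocompact (EuclideanSpace ℝ (Fin dx)),
      P.auxiliary eta x ybar 0 ≤ P.auxiliary eta x ybar v := by
    filter_upwards [(tendsto_norm_cocompact_atTop (E := EuclideanSpace ℝ (Fin dx))).eventually_ge_atTop
      (‖g‖ / c)] with v hv
    have h1 := hP.auxiliary_gradient_inequality eta x ybar 0 v
    rw [sub_zero] at h1
    change P.auxiliary eta x ybar 0 + ⟪g, v⟫_ℝ + c * ‖v‖ ^ 2 ≤ _ at h1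
    have h2 := neg_le_of_abs_le (abs_real_inner_le_norm g v)
    rw [div_le_iff₀ hc] at hv
    have h3 := mul_le_mul_of_nonneg_right hv (norm_nonneg v)
    have h4 : ‖v‖ * c * ‖v‖ = c * ‖v‖ ^ 2 := by ring
    linarith
  obtain ⟨w, hw⟩ := hcont.exists_forall_le' 0 hev
  exact ⟨w, fun v _ => hw v⟩

/-- The distance to the minimizer of the auxiliary function is controlled by the gradient. -/
theorem Standing.norm_sub_le_gradient_auxiliary (hP : P.Standing) {eta : ℝ} (he : 0 < eta)
    (x : EuclideanSpace ℝ (Fin dx)) (ybar : EuclideanSpace ℝ (Fin dy))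
    {w : EuclideanSpace ℝ (Fin dx)} (hw : IsMinOn (P.auxiliary eta x ybar) Set.univ w)
    (u : EuclideanSpace ℝ (Fin dx)) :
    ‖u - w‖ ≤ eta * ‖∇ (P.auxiliary eta x ybar) u‖ := by
  have h1 := hP.gradient_auxiliary_sub eta x ybar u w
  rw [hw.gradient_eq_zero, sub_zero] at h1
  have h2 := hP.strong_monotone u w
  have h3 := real_inner_le_norm (∇ (P.auxiliary eta x ybar) u) (u - w)
  rw [h1, inner_add_left, real_inner_smul_left, real_inner_self_eq_norm_sq, ← h1] at h3
  have h4 := hP.muX_pos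
  have h5 : 0 ≤ P.muX * ‖u - w‖ ^ 2 := by positivity
  rcases (norm_nonneg (u - w)).eq_or_lt with h | h
  · rw [← h]; positivity
  · refine le_of_mul_le_mul_right ?_ h
    have h6 : 1 / eta * ‖u - w‖ ^ 2 ≤ ‖∇ (P.auxiliary eta x ybar) u‖ * ‖u - w‖ := by linarith
    rw [div_mul_eq_mul_div, div_le_iff₀ he] at h6
    linarith

theorem Standing.exists_isRun (hP : P.Standing) (M : GradientMethod (EuclideanSpace ℝ (Fin dx)))
    (p : StepParams) (hx : 0 < p.etaX) (hy : 0 < p.etaY) (x₀ : EuclideanSpace ℝ (Fin dx))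
    (y₀ : EuclideanSpace ℝ (Fin dy)) : ∃ R, P.IsRun M p x₀ y₀ R := by
  have hstep : ∀ (xh : EuclideanSpace ℝ (Fin dx)) (y : EuclideanSpace ℝ (Fin dy)),
      ∃ y' : EuclideanSpace ℝ (Fin dy), ∃ g ∈ subdifferential P.Fstar y',
        y' = y - p.etaY • (g - P.K xh) - (p.etaY * p.betaY) • P.K (P.Kt y + ∇ P.G xh) := by
    intro xh y
    obtain ⟨y', g, hg, h⟩ := hP.F_convex.exists_conjugate_prox
      (y + p.etaY • P.K xh - (p.etaY * p.betaY) • P.K (P.Kt y + ∇ P.G xh)) hy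
    refine ⟨y', g, hg, ?_⟩
    rw [eq_sub_of_add_eq h, smul_sub]
    abel
  choose ny hny using hstep
  choose wm hwm using fun (x : EuclideanSpace ℝ (Fin dx)) (yb : EuclideanSpace ℝ (Fin dy)) =>
    hP.exists_isMinOn_auxiliary hx x yb
  let xh : EuclideanSpace ℝ (Fin dx) → EuclideanSpace ℝ (Fin dy) → EuclideanSpace ℝ (Fin dx) :=
    fun x yb => (M (P.LX + 1 / p.etaX) p.T x).eval (∇ (P.auxiliary p.etaX x yb))
  let S := EuclideanSpace ℝ (Fin dx) × EuclideanSpace ℝ (Fin dy) × EuclideanSpace ℝ (Fin dy) × ℕ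
  let next : S → S := fun s =>
    (s.1 - p.etaX • (∇ P.G (xh s.1 s.2.2.1) + P.Kt s.2.2.1),
      ny (xh s.1 s.2.2.1) s.2.1,
      ny (xh s.1 s.2.2.1) s.2.1 + p.theta • (ny (xh s.1 s.2.2.1) s.2.1 - s.2.1),
      s.2.2.2 + (M (P.LX + 1 / p.etaX) p.T s.1).cost (∇ (P.auxiliary p.etaX s.1 s.2.2.1)) + 1)
  let st : ℕ → S := fun k => Nat.rec (x₀, y₀, y₀, 0) (fun _ s => next s) k
  refine ⟨⟨fun k => (st k).1, fun k => (st k).2.1, fun k => (st k).2.2.1,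
    fun k => xh (st k).1 (st k).2.2.1, fun k => wm (st k).1 (st k).2.2.1, fun k => k,
    fun k => (st k).2.2.2⟩, ?_⟩
  exact
    { x_zero := rfl
      y_zero := rfl
      ybar_zero := rfl
      wstar_min := fun k => hwm _ _
      xhat_eq := fun k => rfl
      x_succ := fun k => rfl
      y_succ := fun k => hny _ _
      ybar_succ := fun k => rfl
      nProx_zero := rfl
      nProx_succ := fun k => rfl
      nGrad_zero := rfl
      nGrad_succ := fun k => rfl }

end SaddleProblem

/-! ### Stepsize estimates and the decrease of the Lyapunov function in one iteration. -/

namespace SaddleProblem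

variable {dx dy : ℕ} {P : SaddleProblem dx dy}

/-! ### The parameters -/

theorem Standing.sqrt_pos (hP : P.Standing) : 0 < √(P.LX * P.muX) :=
  Real.sqrt_pos.2 (mul_pos hP.LX_pos hP.muX_pos)

theorem Standing.etaX_pos (hP : P.Standing) : 0 < P.etaX := by
  have := hP.sqrt_pos
  have := hP.LXY_pos
  have := hP.muXY_pos
  unfold etaX
  positivity

theorem Standing.etaY_pos (hP : P.Standing) : 0 < P.etaY := by
  have := hP.sqrt_pos
  have := hP.LXY_pos
  have := hP.muXY_pos
  unfold etaY
  positivity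

theorem Standing.betaY_pos (hP : P.Standing) : 0 < P.betaY := by
  have := hP.LX_pos
  have := hP.LXY_pos
  have := hP.etaY_pos
  unfold betaY
  positivity

/-- The calibration that lets Young's inequality in `inner_Kt_le` split `⟪Kᵀδ, v⟫` between the
primal and dual metrics. -/
theorem Standing.etaX_mul_etaY (hP : P.Standing) :
    2 * P.etaY * P.LXY ^ 2 = 1 / (16 * P.etaX) := by
  have := hP.sqrt_pos
  have := hP.LXY_pos
  have := hP.muXY_pos
  unfold etaX etaY
  field_simp
  norm_num

theorem Standing.sqrt_kappaX (hP : P.Standing) : √(P.LX / P.muX) * P.muX = √(P.LX * P.muX) := by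
  have h1 := hP.muX_pos
  have h2 := hP.LX_pos
  have e : P.LX * P.muX = P.LX / P.muX * P.muX ^ 2 := by field_simp
  rw [e, Real.sqrt_mul (by positivity), Real.sqrt_sq h1.le]

theorem Standing.LX_eq (hP : P.Standing) : P.LX = √P.kappaX ^ 2 * P.muX := by
  have h1 := hP.muX_pos
  have h2 : 0 ≤ P.kappaX := (div_pos hP.LX_pos h1).le
  rw [Real.sq_sqrt h2, kappaX]
  field_simp

theorem Standing.one_le_sqrt_kappaX (hP : P.Standing) : 1 ≤ √(P.LX / P.muX) := by
  rw [Real.one_le_sqrt, one_le_div hP.muX_pos]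
  exact hP.muX_le

theorem Standing.one_le_kappaXY (hP : P.Standing) : 1 ≤ P.kappaXY := by
  rw [kappaXY, one_le_div hP.muXY_pos]
  exact hP.muXY_le

theorem Standing.muX_mul_etaX (hP : P.Standing) :
    P.muX * P.etaX = 1 / (4 * (√P.kappaX * P.kappaXY)) := by
  have h1 := hP.muX_pos
  have := hP.LXY_pos
  have := hP.muXY_pos
  have := hP.one_le_sqrt_kappaX
  have h3 : √(P.LX / P.muX) ≠ 0 := by linarith
  unfold etaX kappaX kappaXY
  rw [← hP.sqrt_kappaX]
  field_simp

theorem Standing.muX_mul_etaX_le (hP : P.Standing) : P.muX * P.etaX ≤ 1 / 4 := by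
  rw [hP.muX_mul_etaX]
  apply one_div_le_one_div_of_le (by norm_num)
  have h1 : 1 ≤ √P.kappaX := hP.one_le_sqrt_kappaX
  nlinarith [hP.one_le_kappaXY]

theorem Standing.LX_mul_etaX_le (hP : P.Standing) : P.LX * P.etaX ≤ √(P.LX / P.muX) := by
  have h1 := hP.muX_pos
  have h2 := hP.muX_mul_etaX
  have h3 : 1 ≤ √P.kappaX := hP.one_le_sqrt_kappaX
  have h4 := hP.one_le_kappaXY
  change _ ≤ √P.kappaX
  rw [hP.LX_eq, mul_assoc, h2]
  have : √P.kappaX ^ 2 * (1 / (4 * (√P.kappaX * P.kappaXY))) = √P.kappaX / (4 * P.kappaXY) := by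
    have : √P.kappaX ≠ 0 := by linarith
    field_simp
  rw [this]
  apply div_le_self <;> linarith

theorem Standing.betaY_mul_le (hP : P.Standing) : P.betaY * P.LXY ^ 2 ≤ 1 / (2 * P.etaY) := by
  have h1 := hP.LXY_pos
  have h2 := hP.etaY_pos
  refine (mul_le_mul_of_nonneg_right (min_le_right _ _) (sq_nonneg _)).trans (le_of_eq ?_)
  field_simp

theorem Standing.one_div_one_sub_theta (hP : P.Standing) :
    0 < P.theta ∧ P.theta < 1 ∧
      1 / (1 - P.theta) ≤ 9 * max (√P.kappaX * P.kappaXY) (P.kappaXY ^ 2) := by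
  have h1 := hP.muX_pos
  have h2 := hP.etaX_pos
  have h3 := hP.muXY_pos
  have h4 := hP.betaY_pos
  have h5 := hP.etaY_pos
  have h6 := hP.LXY_pos
  have h7 := hP.LX_pos
  have hs : 1 ≤ √P.kappaX := hP.one_le_sqrt_kappaX
  have hk := hP.one_le_kappaXY
  set M := max (√P.kappaX * P.kappaXY) (P.kappaXY ^ 2) with hM
  have hM1 : √P.kappaX * P.kappaXY ≤ M := le_max_left _ _
  have hM2 : P.kappaXY ^ 2 ≤ M := le_max_right _ _
  have hM0 : 1 ≤ M := by nlinarith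
  have hpos : 0 < P.theta := lt_max_of_lt_left (by positivity)
  have ha : 2 / (2 + P.muX * P.etaX) ≤ 1 - 1 / (9 * M) := by
    rw [hP.muX_mul_etaX]
    set q := √P.kappaX * P.kappaXY with hq
    have hq1 : 1 ≤ q := by nlinarith
    -- The constant `9` comes from here: `8q + 1 ≤ 9q`. The other candidate for `θ` only needs `8q`
    -- or `2 κ_xy²`.
    have : 2 / (2 + 1 / (4 * q)) = 1 - 1 / (8 * q + 1) := by field_simp; ring
    rw [this]
    have : 1 / (9 * M) ≤ 1 / (8 * q + 1) := one_div_le_one_div_of_le (by linarith) (by linarith)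
    linarith
  have hb : 1 - P.muXY ^ 2 * P.betaY * P.etaY ≤ 1 - 1 / (9 * M) := by
    have : 1 / (9 * M) ≤ P.muXY ^ 2 * P.betaY * P.etaY := by
      unfold betaY
      rcases min_choice (1 / P.LX) (1 / (2 * P.LXY ^ 2 * P.etaY)) with h | h
      · rw [h]
        have e : P.muXY ^ 2 * (1 / P.LX) * P.etaY = 1 / (8 * (√P.kappaX * P.kappaXY)) := by
          have hs0 : √P.kappaX ≠ 0 := by linarith
          have hsq : √(P.LX * P.muX) = √P.kappaX * P.muX := hP.sqrt_kappaX.symm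
          unfold etaY kappaXY
          rw [hsq]
          nth_rewrite 1 [hP.LX_eq]
          field_simp
        rw [e]
        apply one_div_le_one_div_of_le <;> nlinarith
      · rw [h]
        have e : P.muXY ^ 2 * (1 / (2 * P.LXY ^ 2 * P.etaY)) * P.etaY
            = 1 / (2 * P.kappaXY ^ 2) := by
          unfold kappaXY
          field_simp
        rw [e]
        apply one_div_le_one_div_of_le <;> nlinarith
    linarith
  have hle : P.theta ≤ 1 - 1 / (9 * M) := max_le ha hb
  have h9 : 0 < 1 / (9 * M) := by positivity
  refine ⟨hpos, by linarith, ?_⟩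
  rw [div_le_iff₀ (by linarith)]
  have h10 : 9 * M * (1 / (9 * M)) ≤ 9 * M * (1 - P.theta) :=
    mul_le_mul_of_nonneg_left (by linarith) (by linarith)
  rwa [mul_one_div_cancel (by positivity)] at h10

/-! ### One step of the method -/

theorem norm_sub_sq_identity {E : Type*} [NormedAddCommGroup E] [InnerProductSpace ℝ E]
    (x x' u s : E) :
    ‖x' - s‖ ^ 2 = ‖x - s‖ ^ 2 + 2 * ⟪x' - x, u - s⟫_ℝ + ‖x' - u‖ ^ 2 - ‖x - u‖ ^ 2 := by
  simp only [norm_sub_sq_real, inner_sub_left, inner_sub_right]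
  ring

theorem inner_add_add_identity {E : Type*} [NormedAddCommGroup E] [InnerProductSpace ℝ E]
    (a d e : E) :
    2 * ⟪a + d, a + e⟫_ℝ = ‖a‖ ^ 2 + ‖a + d + e‖ ^ 2 - ‖d‖ ^ 2 - ‖e‖ ^ 2 := by
  simp only [norm_add_sq_real, inner_add_left, inner_add_right, real_inner_self_eq_norm_sq,
    real_inner_comm a d]
  ring

theorem norm_sub_sq_le_two_mul {E : Type*} [NormedAddCommGroup E] [InnerProductSpace ℝ E]
    (u v w : E) : ‖u - v‖ ^ 2 ≤ 2 * ‖u - w‖ ^ 2 + 2 * ‖w - v‖ ^ 2 := by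
  have h := parallelogram_law_with_norm ℝ (u - w) (w - v)
  have e : u - w + (w - v) = u - v := by abel
  rw [e] at h
  nlinarith [mul_self_nonneg ‖u - w - (w - v)‖]

/-- Both updates are expanded around the solution. In the `β_y` term, polarization with `a = Kᵀ(y -
y⋆)`, `d = ∇G(x̂) - ∇G(x⋆)`, `e = Kᵀ(y' - y)` produces the gain `‖a‖²` at the price of `‖d‖² +
‖e‖²`. The two entries of the minimum defining `β_y` pay for `‖d‖²` and `‖e‖²` respectively. -/
theorem Standing.distance_step (hP : P.Standing) {x xh x' xs : EuclideanSpace ℝ (Fin dx)}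
    {y y' yb g ys : EuclideanSpace ℝ (Fin dy)} (hsol : P.IsSolution xs ys)
    (hg : g ∈ subdifferential P.Fstar y')
    (hx' : x' = x - P.etaX • (∇ P.G xh + P.Kt yb))
    (hy' : y' = y - P.etaY • (g - P.K xh) - (P.etaY * P.betaY) • P.K (P.Kt y + ∇ P.G xh))
    (hrange : y - ys ∈ Set.range P.K) :
    1 / P.etaX * ‖x' - xs‖ ^ 2 + 1 / P.etaY * ‖y' - ys‖ ^ 2
      ≤ 1 / P.etaX * ‖x - xs‖ ^ 2
        + (1 - P.muXY ^ 2 * P.betaY * P.etaY) * (1 / P.etaY * ‖y - ys‖ ^ 2)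
        - P.muX * ‖xh - xs‖ ^ 2 + 1 / P.etaX * ‖x' - xh‖ ^ 2 - 1 / P.etaX * ‖x - xh‖ ^ 2
        - 1 / (2 * P.etaY) * ‖y' - y‖ ^ 2 + 2 * ⟪P.Kt (y' - yb), xh - xs⟫_ℝ := by
  have hηx := hP.etaX_pos
  have hηy := hP.etaY_pos
  have hβ := hP.betaY_pos
  have hgrad := IsSolution.gradient_eq hP hsol
  have hgs : ∇ P.G xs = -P.Kt ys := eq_neg_of_add_eq_zero_left hgrad
  set d := ∇ P.G xh - ∇ P.G xs with hd
  have primal : 1 / P.etaX * ‖x' - xs‖ ^ 2 = 1 / P.etaX * ‖x - xs‖ ^ 2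
      - 2 * ⟪d, xh - xs⟫_ℝ - 2 * ⟪P.Kt (yb - ys), xh - xs⟫_ℝ
      + 1 / P.etaX * ‖x' - xh‖ ^ 2 - 1 / P.etaX * ‖x - xh‖ ^ 2 := by
    rw [norm_sub_sq_identity x x' xh xs]
    have e : x' - x = -(P.etaX • (d + P.Kt (yb - ys))) := by
      rw [hx', hd, hgs, map_sub]; module
    rw [e, inner_neg_left, real_inner_smul_left, inner_add_left]
    field_simp
    ring
  have dual : 1 / P.etaY * ‖y' - ys‖ ^ 2 = 1 / P.etaY * ‖y - ys‖ ^ 2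
      - 2 * ⟪g - P.K xs, y' - ys⟫_ℝ + 2 * ⟪P.Kt (y' - ys), xh - xs⟫_ℝ
      - P.betaY * (2 * ⟪P.Kt (y - ys) + d, P.Kt (y - ys) + P.Kt (y' - y)⟫_ℝ)
      - 1 / P.etaY * ‖y' - y‖ ^ 2 := by
    rw [norm_sub_sq_identity y y' y' ys, sub_self, norm_zero, norm_sub_rev y y']
    have e : y' - y = -(P.etaY • ((g - P.K xs) - P.K (xh - xs)
        + P.betaY • P.K (P.Kt (y - ys) + d))) := by
      have e1 : P.Kt (y - ys) + d = P.Kt y + ∇ P.G xh := by rw [hd, hgs, map_sub]; abel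
      rw [e1, hy', map_sub P.K]
      module
    have e2 : P.Kt (y - ys) + P.Kt (y' - y) = P.Kt (y' - ys) := by
      rw [← map_add]; congr 1; abel
    have e3 : ⟪y' - y, y' - ys⟫_ℝ = -(P.etaY * (⟪g - P.K xs, y' - ys⟫_ℝ
        - ⟪P.Kt (y' - ys), xh - xs⟫_ℝ
        + P.betaY * ⟪P.Kt (y - ys) + d, P.Kt (y' - ys)⟫_ℝ)) := by
      rw [e, inner_neg_left, real_inner_smul_left, inner_add_left, inner_sub_left,
        real_inner_smul_left, real_inner_comm (y' - ys) (P.K (xh - xs)), inner_K,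
        real_inner_comm (y' - ys) (P.K (P.Kt (y - ys) + d)), inner_K,
        real_inner_comm (P.Kt (y - ys) + d)]
    rw [e2, e3]
    field_simp
    ring
  have hmono := hP.subgradient_monotone hg (IsSolution.mem_subdifferential hP hsol) hsol.mem_dom
  -- Of the two copies of `⟪d, xh - xs⟫`, one absorbs `β_y ‖d‖²` by cocoercivity and the other gives
  -- `μ_x ‖xh - xs‖²`.
  have hco := hP.isSmoothWith.cocoercive hP.LX_pos hP.convexOn xh xs
  have hst := hP.strong_monotone xh xs
  rw [← hd] at hco hst
  rw [inner_add_add_identity] at dual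
  have hb1 : P.betaY * ‖d‖ ^ 2 ≤ 1 / P.LX * ‖d‖ ^ 2 :=
    mul_le_mul_of_nonneg_right (min_le_left _ _) (sq_nonneg _)
  have hb2 : P.betaY * ‖P.Kt (y' - y)‖ ^ 2 ≤ 1 / (2 * P.etaY) * ‖y' - y‖ ^ 2 := by
    have h1 : ‖P.Kt (y' - y)‖ ^ 2 ≤ (P.LXY * ‖y' - y‖) ^ 2 := by
      gcongr
      exact norm_Kt_le _
    have h2 := mul_le_mul_of_nonneg_left h1 hβ.le
    have h3 := mul_le_mul_of_nonneg_right hP.betaY_mul_le (sq_nonneg ‖y' - y‖)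
    rw [mul_pow] at h2
    linarith
  have hb3 : P.betaY * (P.muXY ^ 2 * ‖y - ys‖ ^ 2) ≤ P.betaY * ‖P.Kt (y - ys)‖ ^ 2 :=
    mul_le_mul_of_nonneg_left (hP.muXY_mul_norm_le hrange) hβ.le
  have hb4 : 0 ≤ P.betaY * ‖P.Kt (y - ys) + d + P.Kt (y' - y)‖ ^ 2 := by positivity
  have e5 : (1 - P.muXY ^ 2 * P.betaY * P.etaY) * (1 / P.etaY * ‖y - ys‖ ^ 2)
      = 1 / P.etaY * ‖y - ys‖ ^ 2 - P.betaY * (P.muXY ^ 2 * ‖y - ys‖ ^ 2) := by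
    field_simp
  have e6 : 1 / P.etaY * ‖y' - y‖ ^ 2 = 2 * (1 / (2 * P.etaY) * ‖y' - y‖ ^ 2) := by
    field_simp
  have e7 : ⟪P.Kt (y' - yb), xh - xs⟫_ℝ
      = ⟪P.Kt (y' - ys), xh - xs⟫_ℝ - ⟪P.Kt (yb - ys), xh - xs⟫_ℝ := by
    rw [← inner_sub_left, ← map_sub, sub_sub_sub_cancel_right]
  rw [e5, e7, primal, dual]
  linarith

/-- The Lyapunov function in terms of the last dual displacement `δ`, the last inexact prox `u` and
the last squared prox distance `S`. -/
noncomputable def energy (P : SaddleProblem dx dy) (xs : EuclideanSpace ℝ (Fin dx))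
    (ys : EuclideanSpace ℝ (Fin dy)) (x : EuclideanSpace ℝ (Fin dx))
    (y δ : EuclideanSpace ℝ (Fin dy)) (u : EuclideanSpace ℝ (Fin dx)) (S : ℝ) : ℝ :=
  (1 + P.muX * P.etaX / 2) * (1 / P.etaX) * ‖x - xs‖ ^ 2 + 1 / P.etaY * ‖y - ys‖ ^ 2
    + 1 / (2 * P.etaY) * ‖δ‖ ^ 2 + 1 / (8 * P.etaX) * S - 2 * ⟪P.Kt δ, u - xs⟫_ℝ

theorem Standing.inner_Kt_le (hP : P.Standing) (δ : EuclideanSpace ℝ (Fin dy))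
    (v : EuclideanSpace ℝ (Fin dx)) :
    2 * |⟪P.Kt δ, v⟫_ℝ| ≤ 1 / (2 * P.etaY) * ‖δ‖ ^ 2 + 1 / (16 * P.etaX) * ‖v‖ ^ 2 := by
  have hηy := hP.etaY_pos
  have h1 := abs_real_inner_le_norm (P.Kt δ) v
  have h2 := mul_le_mul_of_nonneg_right (norm_Kt_le (P := P) δ) (norm_nonneg v)
  rw [← hP.etaX_mul_etaY]
  have h3 : 0 ≤ 1 / (2 * P.etaY) * (‖δ‖ - 2 * P.etaY * P.LXY * ‖v‖) ^ 2 := by positivity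
  have h4 : 1 / (2 * P.etaY) * (‖δ‖ - 2 * P.etaY * P.LXY * ‖v‖) ^ 2
      = 1 / (2 * P.etaY) * ‖δ‖ ^ 2 - 2 * (P.LXY * ‖δ‖ * ‖v‖)
        + 2 * P.etaY * P.LXY ^ 2 * ‖v‖ ^ 2 := by
    field_simp
    ring
  linarith

/-- Young's inequality spends all of the `‖δ‖²` term and a part of the distance `‖u - xs‖²`. As `u`
is close to `x`, the latter costs `‖x - xs‖²/(8η_x)` plus an error covered by the `S` term. -/
theorem Standing.le_energy (hP : P.Standing) (xs x u : EuclideanSpace ℝ (Fin dx))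
    (ys y δ : EuclideanSpace ℝ (Fin dy)) {S : ℝ} (hu : ‖x - u‖ ^ 2 ≤ S / 20) :
    1 / (2 * P.etaX) * ‖x - xs‖ ^ 2 + 1 / P.etaY * ‖y - ys‖ ^ 2
      ≤ P.energy xs ys x y δ u S := by
  have hηx := hP.etaX_pos
  have hμ := hP.muX_pos
  have h1 := hP.inner_Kt_le δ (u - xs)
  have h2 := norm_sub_sq_le_two_mul u xs x
  rw [norm_sub_rev u x] at h2
  have h3 := le_abs_self ⟪P.Kt δ, u - xs⟫_ℝ
  unfold energy
  set I := 1 / P.etaX with hI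
  have hI0 : 0 < I := by positivity
  have e1 : 1 / (16 * P.etaX) = I / 16 := by rw [hI]; field_simp
  have e2 : 1 / (8 * P.etaX) = I / 8 := by rw [hI]; field_simp
  have e3 : 1 / (2 * P.etaX) = I / 2 := by rw [hI]; field_simp
  have e4 : (1 + P.muX * P.etaX / 2) * I = I + P.muX / 2 := by rw [hI]; field_simp
  rw [e1] at h1
  rw [e2, e3, e4]
  have h4 := mul_le_mul_of_nonneg_left h2 hI0.le
  have h5 := mul_le_mul_of_nonneg_left hu hI0.le
  have h6 : 0 ≤ P.muX / 2 * ‖x - xs‖ ^ 2 := by positivity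
  have h7 : 0 ≤ I * ‖x - xs‖ ^ 2 := by positivity
  have h8 : 0 ≤ I * ‖x - u‖ ^ 2 := by positivity
  linarith

/-- Extrapolation turns the bilinear term into the inner product of the new energy minus `θ` times
the old one, up to `⟪Kᵀδ, xh - u⟫`. Young's inequality charges that remainder to the old `‖δ‖²` and
`S` terms and to `‖x - xh‖²`. Transferring strong convexity from `xh` to `x'` costs `μ_x ‖x' -
xh‖²`. The inexactness and the new `‖x - w‖²/(8η_x)` are paid by `-‖x - xh‖²/η_x`, because `‖x -
w‖²` is at most a constant times `‖x - xh‖²`. -/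
theorem Standing.energy_step (hP : P.Standing) {x xh x' xs u w : EuclideanSpace ℝ (Fin dx)}
    {y y' yb g ys δ : EuclideanSpace ℝ (Fin dy)} {S : ℝ} (hsol : P.IsSolution xs ys)
    (hg : g ∈ subdifferential P.Fstar y')
    (hx' : x' = x - P.etaX • (∇ P.G xh + P.Kt yb))
    (hy' : y' = y - P.etaY • (g - P.K xh) - (P.etaY * P.betaY) • P.K (P.Kt y + ∇ P.G xh))
    (hrange : y - ys ∈ Set.range P.K) (hyb : yb = y + P.theta • δ)
    (hu : ‖x - u‖ ^ 2 ≤ S / 20) (hx1 : ‖x' - xh‖ ^ 2 ≤ ‖x - w‖ ^ 2 / 20)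
    (hw : ‖xh - w‖ ^ 2 ≤ ‖x - w‖ ^ 2 / 20) :
    P.energy xs ys x' y' (y' - y) xh (‖x - w‖ ^ 2)
      ≤ P.theta * P.energy xs ys x y δ u S := by
  have hηx := hP.etaX_pos
  have hηy := hP.etaY_pos
  have hμ := hP.muX_pos
  obtain ⟨hθ0, hθ1, -⟩ := hP.one_div_one_sub_theta
  have main := hP.distance_step hsol hg hx' hy' hrange
  have hcross : ⟪P.Kt (y' - yb), xh - xs⟫_ℝ = ⟪P.Kt (y' - y), xh - xs⟫_ℝ
      - P.theta * ⟪P.Kt δ, u - xs⟫_ℝ - P.theta * ⟪P.Kt δ, xh - u⟫_ℝ := by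
    have e1 : y' - yb = (y' - y) - P.theta • δ := by rw [hyb]; abel
    have e2 : xh - xs = (u - xs) + (xh - u) := by abel
    rw [e1, map_sub, map_smul, inner_sub_left, real_inner_smul_left]
    nth_rewrite 2 [e2]
    rw [inner_add_right]
    ring
  have h1 := hP.inner_Kt_le δ (xh - u)
  have h2 := neg_abs_le ⟪P.Kt δ, xh - u⟫_ℝ
  have h3 := norm_sub_sq_le_two_mul xh u x
  have h4 := norm_sub_sq_le_two_mul x' xs xh
  have h5 := norm_sub_sq_le_two_mul x w xh
  rw [norm_sub_rev xh x] at h3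
  have hthx : 1 / P.etaX ≤ P.theta * (1 / P.etaX + P.muX / 2) := by
    have h : 2 / (2 + P.muX * P.etaX) ≤ P.theta := le_max_left _ _
    have := mul_le_mul_of_nonneg_right h (by positivity : 0 ≤ 1 / P.etaX + P.muX / 2)
    refine le_trans (le_of_eq ?_) this
    have : 2 + P.muX * P.etaX ≠ 0 := by positivity
    field_simp
  have hthy : 1 - P.muXY ^ 2 * P.betaY * P.etaY ≤ P.theta := le_max_right _ _
  have hμI : P.muX ≤ 1 / P.etaX / 4 := by
    rw [div_div, le_div_iff₀ (by positivity)]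
    linarith [hP.muX_mul_etaX_le]
  unfold energy
  set I := 1 / P.etaX with hI
  have hI0 : 0 < I := by positivity
  have e1 : 1 / (16 * P.etaX) = I / 16 := by rw [hI]; field_simp
  have e2 : 1 / (8 * P.etaX) = I / 8 := by rw [hI]; field_simp
  have e4 : (1 + P.muX * P.etaX / 2) * I = I + P.muX / 2 := by rw [hI]; field_simp
  rw [e1] at h1
  rw [hcross] at main
  rw [e2, e4]
  have k1 : -2 * ⟪P.Kt δ, xh - u⟫_ℝ
      ≤ 1 / (2 * P.etaY) * ‖δ‖ ^ 2 + I / 8 * ‖x - xh‖ ^ 2 + I / 8 * (S / 20) := by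
    have a1 := mul_le_mul_of_nonneg_left h3 hI0.le
    have a2 := mul_le_mul_of_nonneg_left hu hI0.le
    linarith
  have k2 := mul_le_mul_of_nonneg_left k1 hθ0.le
  have k3 := mul_le_mul_of_nonneg_right hthx (sq_nonneg ‖x - xs‖)
  have k4 := mul_le_mul_of_nonneg_right hthy
    (by positivity : 0 ≤ 1 / P.etaY * ‖y - ys‖ ^ 2)
  have k5 := mul_le_mul_of_nonneg_left h4 (by positivity : 0 ≤ P.muX / 2)
  have k6 := mul_le_mul_of_nonneg_right hμI (sq_nonneg ‖x' - xh‖)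
  have k7 := mul_le_mul_of_nonneg_left hx1 hI0.le
  have k8 := mul_le_mul_of_nonneg_left hw hI0.le
  have k9 := mul_le_mul_of_nonneg_left h5 hI0.le
  have k10 : 0 ≤ I * ‖x - xh‖ ^ 2 := by positivity
  have k11 := mul_le_mul_of_nonneg_right hθ1.le k10
  have k12 : 0 ≤ I * ‖x - w‖ ^ 2 := by positivity
  have hS : 0 ≤ S := by linarith [sq_nonneg ‖x - u‖]
  have k13 : 0 ≤ P.theta * (I * S) := by positivity
  linarith

end SaddleProblem

/-! ### From one step to whole runs and oracle counts. -/

namespace SaddleProblem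

variable {dx dy : ℕ} {P : SaddleProblem dx dy}

/-! ### Runs with an accurate inner method -/

/-- The inner method solves the auxiliary problems to the relative accuracy that the outer method
needs. -/
theorem Standing.inner_accuracy (hP : P.Standing)
    {M : GradientMethod (EuclideanSpace ℝ (Fin dx))} {A α : ℝ} (hA : 0 < A) (hα : 2 ≤ α)
    (hM : HasGradientRate M A α) {T : ℕ} (hT : P.innerIterations A α ≤ T)
    {x w : EuclideanSpace ℝ (Fin dx)} {yb : EuclideanSpace ℝ (Fin dy)}
    (hw : IsMinOn (P.auxiliary P.etaX x yb) Set.univ w) :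
    P.etaX ^ 2 * ‖∇ (P.auxiliary P.etaX x yb)
      ((M (P.LX + 1 / P.etaX) T x).eval (∇ (P.auxiliary P.etaX x yb)))‖ ^ 2
      ≤ ‖x - w‖ ^ 2 / 20 := by
  have hη := hP.etaX_pos
  have hL := hP.LX_pos
  have hκ := hP.one_le_sqrt_kappaX
  have hα0 : α ≠ 0 := by linarith
  have hi : 0 < P.innerIterations A α := by
    unfold innerIterations
    positivity
  have hT0 : (0 : ℝ) < T := hi.trans_le hT
  have hT1 : 1 ≤ T := by exact_mod_cast hT0
  have h1 := hM.2 (P.LX + 1 / P.etaX) (P.auxiliary P.etaX x yb) (by positivity)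
    (hP.convexOn_auxiliary hη x yb) (hP.isSmoothWith_auxiliary hη x yb) w hw x T hT1
  -- This is the lower bound on `T` raised to the power `α`.
  have h2 : 20 * A * (1 + √(P.LX / P.muX)) ^ 2 ≤ (T : ℝ) ^ α := by
    have h3 := Real.rpow_le_rpow hi.le hT (by linarith : 0 ≤ α)
    refine le_trans (le_of_eq ?_) h3
    unfold innerIterations
    rw [Real.mul_rpow (by positivity) (by positivity), ← Real.rpow_mul (by positivity),
      ← Real.rpow_mul (by positivity), one_div_mul_cancel hα0, div_mul_cancel₀ _ hα0,
      Real.rpow_one]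
    norm_cast
  refine (mul_le_mul_of_nonneg_left h1 (sq_nonneg P.etaX)).trans ?_
  rw [← mul_div_assoc, div_le_div_iff₀ (by positivity) (by norm_num)]
  have h4 : P.etaX ^ 2 * (P.LX + 1 / P.etaX) ^ 2 ≤ (1 + √(P.LX / P.muX)) ^ 2 := by
    have : P.etaX ^ 2 * (P.LX + 1 / P.etaX) ^ 2 = (1 + P.LX * P.etaX) ^ 2 := by
      field_simp
      ring
    rw [this]
    have := hP.LX_mul_etaX_le
    gcongr
  have h5 := mul_le_mul_of_nonneg_left h4 (by positivity : 0 ≤ 20 * A * ‖x - w‖ ^ 2)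
  have h6 := mul_le_mul_of_nonneg_left h2 (sq_nonneg ‖x - w‖)
  linarith

section Run

variable {M : GradientMethod (EuclideanSpace ℝ (Fin dx))} {A α : ℝ} {T : ℕ}
  {x₀ xs : EuclideanSpace ℝ (Fin dx)} {y₀ ys : EuclideanSpace ℝ (Fin dy)} {R : Run dx dy}

theorem Standing.run_accuracy (hP : P.Standing) (hA : 0 < A) (hα : 2 ≤ α)
    (hM : HasGradientRate M A α) (hT : P.innerIterations A α ≤ T)
    (hR : P.IsRun M (P.params T) x₀ y₀ R) (k : ℕ) :
    ‖R.x (k + 1) - R.xhat k‖ ^ 2 ≤ ‖R.x k - R.wstar k‖ ^ 2 / 20 ∧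
      ‖R.xhat k - R.wstar k‖ ^ 2 ≤ ‖R.x k - R.wstar k‖ ^ 2 / 20 := by
  have hη := hP.etaX_pos
  have hw : IsMinOn (P.auxiliary P.etaX (R.x k) (R.ybar k)) Set.univ (R.wstar k) :=
    hR.wstar_min k
  have h1 := hP.inner_accuracy hA hα hM hT hw
  have hxh : R.xhat k = (M (P.LX + 1 / P.etaX) T (R.x k)).eval
    (∇ (P.auxiliary P.etaX (R.x k) (R.ybar k))) := hR.xhat_eq k
  rw [← hxh] at h1
  have h2 := hP.norm_sub_le_gradient_auxiliary hη (R.x k) (R.ybar k) hw (R.xhat k)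
  have hx : R.x (k + 1) = R.x k - P.etaX • (∇ P.G (R.xhat k) + P.Kt (R.ybar k)) := hR.x_succ k
  -- The update misses the inner output by exactly `η_x ∇Ψ^k`, so one gradient bound controls both
  -- errors.
  have h3 : R.x (k + 1) - R.xhat k
      = -(P.etaX • ∇ (P.auxiliary P.etaX (R.x k) (R.ybar k)) (R.xhat k)) := by
    rw [hx, hP.gradient_auxiliary, smul_add P.etaX _ ((1 / P.etaX) • _), smul_smul, mul_one_div_cancel hη.ne', one_smul]
    module
  constructor
  · rw [h3, norm_neg, norm_smul, mul_pow, Real.norm_eq_abs, sq_abs]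
    exact h1
  · refine le_trans ?_ h1
    rw [← mul_pow]
    gcongr

theorem Standing.run_range (hP : P.Standing) (hR : P.IsRun M (P.params T) x₀ y₀ R)
    (hs : P.IsReachableSolution y₀ xs ys) (k : ℕ) : R.y k - ys ∈ Set.range P.K := by
  induction k with
  | zero =>
    obtain ⟨a, ha⟩ := hs.2
    exact ⟨-a, by rw [map_neg, ha, hR.y_zero, neg_sub]⟩
  | succ k ih =>
    obtain ⟨g, hg, h⟩ := hR.y_succ k
    obtain ⟨a, ha⟩ := ih
    obtain ⟨c, rfl⟩ := hP.subdifferential_subset _ hg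
    refine ⟨a - (P.params T).etaY • (c - R.xhat k)
      - ((P.params T).etaY * (P.params T).betaY) • (P.Kt (R.y k) + ∇ P.G (R.xhat k)), ?_⟩
    rw [h, map_sub, map_sub, map_smul, map_smul, ha, map_sub]
    abel

/-- The Lyapunov function of a run in terms of `energy`. -/
theorem Standing.exists_lyapunov_eq (hP : P.Standing) (hA : 0 < A) (hα : 2 ≤ α)
    (hM : HasGradientRate M A α) (hT : P.innerIterations A α ≤ T)
    (hR : P.IsRun M (P.params T) x₀ y₀ R) (xs : EuclideanSpace ℝ (Fin dx))
    (ys : EuclideanSpace ℝ (Fin dy)) (k : ℕ) :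
    ∃ δ u S, R.ybar k = R.y k + P.theta • δ ∧ ‖R.x k - u‖ ^ 2 ≤ S / 20 ∧
      P.lyapunov (P.params T) R xs ys k = P.energy xs ys (R.x k) (R.y k) δ u S := by
  cases k with
  | zero =>
    -- At the start `ȳ⁰ = y⁰`: zero displacement and zero prox distance put `Δ⁰` into the same form
    -- as the later values.
    refine ⟨0, R.x 0, 0, ?_, ?_, ?_⟩
    · rw [smul_zero, add_zero, hR.ybar_zero, hR.y_zero]
    · simp
    · simp [lyapunov, energy, params]
  | succ k =>
    refine ⟨R.y (k + 1) - R.y k, R.xhat k, ‖R.x k - R.wstar k‖ ^ 2, hR.ybar_succ k,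
      (hP.run_accuracy hA hα hM hT hR k).1, ?_⟩
    rw [energy, map_sub]
    rfl

theorem Standing.lyapunov_succ_le (hP : P.Standing) (hA : 0 < A) (hα : 2 ≤ α)
    (hM : HasGradientRate M A α) (hT : P.innerIterations A α ≤ T)
    (hR : P.IsRun M (P.params T) x₀ y₀ R) (hs : P.IsReachableSolution y₀ xs ys) (k : ℕ) :
    P.lyapunov (P.params T) R xs ys (k + 1) ≤ P.theta * P.lyapunov (P.params T) R xs ys k := by
  obtain ⟨δ, u, S, h1, h2, h3⟩ := hP.exists_lyapunov_eq hA hα hM hT hR xs ys k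
  obtain ⟨g, hg, hy⟩ := hR.y_succ k
  obtain ⟨a1, a2⟩ := hP.run_accuracy hA hα hM hT hR k
  have h := hP.energy_step hs.1 hg (hR.x_succ k) hy (hP.run_range hR hs k) h1 h2 a1 a2
  rw [h3]
  refine le_trans (le_of_eq ?_) h
  rw [energy, map_sub]
  rfl

theorem Standing.le_lyapunov (hP : P.Standing) (hA : 0 < A) (hα : 2 ≤ α)
    (hM : HasGradientRate M A α) (hT : P.innerIterations A α ≤ T)
    (hR : P.IsRun M (P.params T) x₀ y₀ R) (xs : EuclideanSpace ℝ (Fin dx))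
    (ys : EuclideanSpace ℝ (Fin dy)) (k : ℕ) :
    1 / (2 * P.etaX) * ‖R.x k - xs‖ ^ 2 + 1 / P.etaY * ‖R.y k - ys‖ ^ 2
      ≤ P.lyapunov (P.params T) R xs ys k := by
  obtain ⟨δ, u, S, h1, h2, h3⟩ := hP.exists_lyapunov_eq hA hα hM hT hR xs ys k
  rw [h3]
  exact hP.le_energy xs (R.x k) u ys (R.y k) δ h2

theorem Standing.lyapunov_nonneg (hP : P.Standing) (hA : 0 < A) (hα : 2 ≤ α)
    (hM : HasGradientRate M A α) (hT : P.innerIterations A α ≤ T)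
    (hR : P.IsRun M (P.params T) x₀ y₀ R) (xs : EuclideanSpace ℝ (Fin dx))
    (ys : EuclideanSpace ℝ (Fin dy)) (k : ℕ) : 0 ≤ P.lyapunov (P.params T) R xs ys k := by
  refine le_trans ?_ (hP.le_lyapunov hA hα hM hT hR xs ys k)
  have := hP.etaX_pos
  have := hP.etaY_pos
  positivity

theorem Standing.lyapunov_le_pow (hP : P.Standing) (hA : 0 < A) (hα : 2 ≤ α)
    (hM : HasGradientRate M A α) (hT : P.innerIterations A α ≤ T)
    (hR : P.IsRun M (P.params T) x₀ y₀ R) (hs : P.IsReachableSolution y₀ xs ys) (k : ℕ) :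
    P.lyapunov (P.params T) R xs ys k
      ≤ P.theta ^ k * P.lyapunov (P.params T) R xs ys 0 := by
  induction k with
  | zero => simp
  | succ k ih =>
    refine (hP.lyapunov_succ_le hA hα hM hT hR hs k).trans ?_
    have := mul_le_mul_of_nonneg_left ih hP.one_div_one_sub_theta.1.le
    rw [pow_succ]
    linarith

theorem IsRun.nProx_eq {p : StepParams} (hR : P.IsRun M p x₀ y₀ R) (k : ℕ) : R.nProx k = k := by
  induction k with
  | zero => exact hR.nProx_zero
  | succ k ih => rw [hR.nProx_succ, ih]

theorem IsRun.nGrad_le {p : StepParams} (hM : HasGradientRate M A α)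
    (hR : P.IsRun M p x₀ y₀ R) (k : ℕ) : R.nGrad k ≤ k * (p.T + 1) := by
  induction k with
  | zero => rw [hR.nGrad_zero]; exact Nat.zero_le _
  | succ k ih =>
    rw [hR.nGrad_succ, add_mul, one_mul, add_assoc]
    exact add_le_add ih (Nat.add_le_add_right (hM.1 _ _ _ _) 1)

end Run

/-! ### Complexity -/

theorem Standing.innerIterations_le (hP : P.Standing) {A α : ℝ} (hA : 0 < A) (hα : 2 ≤ α) :
    P.innerIterations A α ≤ 10 * ((max 1 A) ^ (1 / α) * P.kappaX ^ (1 / α)) := by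
  have hα0 : 0 < α := by linarith
  have hs : 1 ≤ √P.kappaX := hP.one_le_sqrt_kappaX
  have hκ0 : 0 ≤ P.kappaX := (div_pos hP.LX_pos hP.muX_pos).le
  have hm : (0 : ℝ) < max 1 A := lt_max_of_lt_left one_pos
  have hα1 : 1 / α ≤ 1 / 2 := one_div_le_one_div_of_le two_pos hα
  have h20 : (20 : ℝ) ^ (1 / α) ≤ 5 := by
    calc (20 : ℝ) ^ (1 / α) ≤ (20 : ℝ) ^ (1 / 2 : ℝ) :=
          Real.rpow_le_rpow_of_exponent_le (by norm_num) hα1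
      _ = √20 := (Real.sqrt_eq_rpow 20).symm
      _ ≤ 5 := Real.sqrt_le_iff.2 ⟨by norm_num, by norm_num⟩
  have h1 : (20 * A) ^ (1 / α) ≤ 5 * (max 1 A) ^ (1 / α) := by
    calc (20 * A) ^ (1 / α) ≤ (20 * max 1 A) ^ (1 / α) := by
          gcongr
          exact le_max_right _ _
      _ = 20 ^ (1 / α) * (max 1 A) ^ (1 / α) := Real.mul_rpow (by norm_num) hm.le
      _ ≤ _ := by gcongr
  have h2 : (1 + √P.kappaX) ^ (2 / α) ≤ 2 * P.kappaX ^ (1 / α) := by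
    calc (1 + √P.kappaX) ^ (2 / α) ≤ (2 * √P.kappaX) ^ (2 / α) := by
          gcongr
          linarith
      _ = 2 ^ (2 / α) * √P.kappaX ^ (2 / α) := Real.mul_rpow (by norm_num) (by linarith)
      _ = 2 ^ (2 / α) * P.kappaX ^ (1 / α) := by
          rw [Real.sqrt_eq_rpow, ← Real.rpow_mul hκ0]
          congr 2
          ring
      _ ≤ 2 ^ (1 : ℝ) * P.kappaX ^ (1 / α) := by
          have : 2 / α ≤ 1 := (div_le_one hα0).2 hα
          gcongr
          norm_num
      _ = _ := by rw [Real.rpow_one]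
  calc P.innerIterations A α
      = (20 * A) ^ (1 / α) * (1 + √P.kappaX) ^ (2 / α) := rfl
    _ ≤ (5 * (max 1 A) ^ (1 / α)) * (2 * P.kappaX ^ (1 / α)) := by gcongr
    _ = _ := by ring

theorem Standing.kappaX_rpow_mul_max (hP : P.Standing) {α : ℝ} (hα : 2 ≤ α) :
    P.kappaX ^ (1 / α) * max (√P.kappaX * P.kappaXY) (P.kappaXY ^ 2)
      = max (P.kappaX ^ ((2 + α) / (2 * α)) * P.kappaXY)
          (P.kappaX ^ (1 / α) * P.kappaXY ^ 2) := by
  have hκ : 0 < P.kappaX := div_pos hP.LX_pos hP.muX_pos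
  have hα0 : α ≠ 0 := by linarith
  rw [mul_max_of_nonneg _ _ (by positivity), ← mul_assoc, Real.sqrt_eq_rpow,
    ← Real.rpow_add hκ]
  congr 3
  field_simp

theorem SolvesWithin.mono {M : GradientMethod (EuclideanSpace ℝ (Fin dx))} {p : StepParams}
    {ε a b a' b' : ℝ} (h : P.SolvesWithin M p ε a b) (ha : a ≤ a') (hb : b ≤ b') :
    P.SolvesWithin M p ε a' b' := by
  obtain ⟨N, hN⟩ := h
  refine ⟨N, fun x₀ y₀ R hR => ?_⟩
  obtain ⟨h1, h2, h3⟩ := hN x₀ y₀ R hR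
  exact ⟨h1.trans ha, h2.trans hb, h3⟩

theorem Standing.solvesWithin (hP : P.Standing)
    {M : GradientMethod (EuclideanSpace ℝ (Fin dx))} {A α ε : ℝ} (hA : 0 < A) (hα : 2 ≤ α)
    (hM : HasGradientRate M A α) (hε : 0 < ε) (hε2 : ε ≤ 1 / 2) :
    P.SolvesWithin M (P.params ⌈P.innerIterations A α⌉₊) ε
      (11 * max (√P.kappaX * P.kappaXY) (P.kappaXY ^ 2) * Real.log (1 / ε))
      (132 * (max 1 A) ^ (1 / α) *
        max (P.kappaX ^ ((2 + α) / (2 * α)) * P.kappaXY)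
          (P.kappaX ^ (1 / α) * P.kappaXY ^ 2) * Real.log (1 / ε)) := by
  obtain ⟨hθ0, hθ1, hθ⟩ := hP.one_div_one_sub_theta
  have hκx : 1 ≤ P.kappaX := (one_le_div hP.muX_pos).2 hP.muX_le
  have hs : 1 ≤ √P.kappaX := hP.one_le_sqrt_kappaX
  have hk := hP.one_le_kappaXY
  rw [← hP.kappaX_rpow_mul_max hα]
  set m := max (√P.kappaX * P.kappaXY) (P.kappaXY ^ 2) with hm
  have hm1 : 1 ≤ m := le_max_of_le_right (by nlinarith)
  set l := Real.log (1 / ε) with hl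
  -- The restriction `ε ≤ 1/2` keeps the logarithm away from `0`, so rounding `N` up costs at most
  -- `2 m l`: `9 + 2 = 11`.
  have hl1 : 1 / 2 ≤ l := by
    have h1 : Real.log 2 ≤ l := by
      apply Real.log_le_log two_pos
      rw [le_div_iff₀ hε]
      linarith
    linarith [Real.log_two_gt_d9]
  set B := (max 1 A) ^ (1 / α) with hB
  set κ := P.kappaX ^ (1 / α) with hκ
  have hα1 : 0 ≤ 1 / α := by positivity
  have hB1 : 1 ≤ B := Real.one_le_rpow (le_max_left _ _) hα1
  have hκ1 : 1 ≤ κ := Real.one_le_rpow hκx hα1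
  have hi := hP.innerIterations_le hA hα
  rw [← hB, ← hκ] at hi
  set T := ⌈P.innerIterations A α⌉₊ with hT
  have hi0 : 0 ≤ P.innerIterations A α := by
    unfold innerIterations
    positivity
  -- One unit for rounding up and one for the gradient at `x̂^k`, both absorbed since `B κ ≥ 1`.
  -- With the `11` of `hNle` this gives `132`.
  have hTle : (T : ℝ) + 1 ≤ 12 * (B * κ) := by
    have h1 := Nat.ceil_lt_add_one hi0
    have h2 : 1 ≤ B * κ := by nlinarith
    linarith
  set N := ⌈l / (1 - P.theta)⌉₊ with hN
  have h1θ : 0 < 1 - P.theta := by linarith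
  have hNle : (N : ℝ) ≤ 11 * m * l := by
    have h1 := Nat.ceil_lt_add_one (div_nonneg (by linarith : 0 ≤ l) h1θ.le)
    have h2 : l / (1 - P.theta) ≤ 9 * m * l := by
      have := mul_le_mul_of_nonneg_right hθ (by linarith : 0 ≤ l)
      rwa [one_div_mul_eq_div] at this
    have h3 : 1 ≤ 2 * (m * l) := by nlinarith
    linarith
  have hpow : P.theta ^ N ≤ ε := by
    have h1 : P.theta ≤ Real.exp (-(1 - P.theta)) := by
      have := Real.add_one_le_exp (-(1 - P.theta))
      linarith
    calc P.theta ^ N ≤ Real.exp (-(1 - P.theta)) ^ N := by gcongr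
      _ = Real.exp (-((1 - P.theta) * N)) := by rw [← Real.exp_nat_mul]; congr 1; ring
      _ ≤ Real.exp (-l) := by
          have h2 := Nat.le_ceil (l / (1 - P.theta))
          rw [div_le_iff₀ h1θ] at h2
          apply Real.exp_le_exp.2
          linarith
      _ = ε := by
          rw [hl, one_div, Real.log_inv, neg_neg, Real.exp_log hε]
  refine ⟨N, fun x₀ y₀ R hR => ⟨?_, ?_, fun xs ys hsol k hk => ?_⟩⟩
  · rw [hR.nProx_eq]
    exact hNle
  · have h1 : (R.nGrad N : ℝ) ≤ N * (T + 1) := by exact_mod_cast hR.nGrad_le hM N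
    calc (R.nGrad N : ℝ) ≤ N * (T + 1) := h1
      _ ≤ (11 * m * l) * (12 * (B * κ)) := by gcongr
      _ = _ := by ring
  · have hTi : P.innerIterations A α ≤ T := Nat.le_ceil _
    refine (hP.lyapunov_le_pow hA hα hM hTi hR hsol k).trans ?_
    refine mul_le_mul_of_nonneg_right ?_ (hP.lyapunov_nonneg hA hα hM hTi hR xs ys 0)
    exact (pow_le_pow_of_le_one hθ0.le hθ1.le hk).trans hpow

/-- The complexity for a rate whose constant satisfies `A ^ (1 / α) ≤ 4`. -/
theorem Standing.solvesWithin_of_rpow_le (hP : P.Standing)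
    {M : GradientMethod (EuclideanSpace ℝ (Fin dx))} {A α β γ ε : ℝ} (hA : 1 ≤ A) (hα : 2 ≤ α)
    (hA4 : A ≤ 4 ^ α) (hβ : β = (2 + α) / (2 * α)) (hγ : γ = 1 / α)
    (hM : HasGradientRate M A α) (hε : 0 < ε) (hε2 : ε ≤ 1 / 2) :
    P.SolvesWithin M (P.params ⌈P.innerIterations A α⌉₊) ε
      (528 * max (√P.kappaX * P.kappaXY) (P.kappaXY ^ 2) * Real.log (1 / ε))
      (528 * max (P.kappaX ^ β * P.kappaXY) (P.kappaX ^ γ * P.kappaXY ^ 2)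
        * Real.log (1 / ε)) := by
  subst hβ hγ
  have hl : 0 ≤ Real.log (1 / ε) := Real.log_nonneg (by rw [le_div_iff₀ hε]; linarith)
  have hB : (max 1 A) ^ (1 / α) ≤ 4 := by
    rw [max_eq_right hA]
    calc A ^ (1 / α) ≤ (4 ^ α) ^ (1 / α) := by gcongr
      _ = 4 := by
        rw [← Real.rpow_mul (by norm_num), mul_one_div_cancel (by linarith), Real.rpow_one]
  have hm : 0 ≤ max (√P.kappaX * P.kappaXY) (P.kappaXY ^ 2) := le_max_of_le_right (sq_nonneg _)
  have hm' : 0 ≤ max (P.kappaX ^ ((2 + α) / (2 * α)) * P.kappaXY)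
      (P.kappaX ^ (1 / α) * P.kappaXY ^ 2) := by
    have : 0 < P.kappaX := div_pos hP.LX_pos hP.muX_pos
    exact le_max_of_le_right (by positivity)
  refine (hP.solvesWithin (by linarith) hα hM hε hε2).mono ?_ ?_
  · gcongr
    norm_num
  · gcongr
    linarith

end SaddleProblem

theorem mainTheorem2 :
    ∃ C : ℝ, 0 < C ∧
    ∀ (dx dy : ℕ) (P : SaddleProblem dx dy), P.Standing →
      -- for every starting point there is exactly one reachable solution
      (∀ y₀, ∃! z : EuclideanSpace ℝ (Fin dx) × EuclideanSpace ℝ (Fin dy),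
        P.IsReachableSolution y₀ z.1 z.2) ∧
      -- the algorithm is well defined
      (∀ (M : GradientMethod (EuclideanSpace ℝ (Fin dx))) (p : SaddleProblem.StepParams),
        0 < p.etaX → 0 < p.etaY → ∀ x₀ y₀, ∃ R, P.IsRun M p x₀ y₀ R) ∧
      -- a general inner method
      (∀ (A α : ℝ), 0 < A → 2 ≤ α → ∀ M : GradientMethod (EuclideanSpace ℝ (Fin dx)),
        HasGradientRate M A α →
        -- linear convergence
        (∀ T : ℕ, P.innerIterations A α ≤ T →
          0 < P.theta ∧ P.theta < 1 ∧
          ∀ x₀ y₀ R, P.IsRun M (P.params T) x₀ y₀ R →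
            ∀ xs ys, P.IsReachableSolution y₀ xs ys → ∀ k : ℕ,
              P.lyapunov (P.params T) R xs ys (k + 1)
                ≤ P.theta * P.lyapunov (P.params T) R xs ys k ∧
              1 / (2 * P.etaX) * ‖R.x k - xs‖ ^ 2
                + 1 / P.etaY * ‖R.y k - ys‖ ^ 2
                ≤ P.lyapunov (P.params T) R xs ys k ∧
              1 / (2 * P.etaX) * ‖R.x (k + 1) - xs‖ ^ 2
                + 1 / P.etaY * ‖R.y (k + 1) - ys‖ ^ 2
                ≤ P.lyapunov (P.params T) R xs ys k ∧
              P.lyapunov (P.params T) R xs ys k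
                ≤ P.theta ^ k * P.lyapunov (P.params T) R xs ys 0) ∧
        -- complexity
        (∀ ε : ℝ, 0 < ε → ε ≤ 1 / 2 →
          P.SolvesWithin M (P.params ⌈P.innerIterations A α⌉₊) ε
            (C * max (√P.kappaX * P.kappaXY) (P.kappaXY ^ 2) * Real.log (1 / ε))
            (C * (max 1 A) ^ (1 / α) *
              max (P.kappaX ^ ((2 + α) / (2 * α)) * P.kappaXY)
                (P.kappaX ^ (1 / α) * P.kappaXY ^ 2) * Real.log (1 / ε)))) ∧
      -- the three concrete inner methods: GD, FGD + GD, FGD + FSFOM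
      (∀ ε : ℝ, 0 < ε → ε ≤ 1 / 2 →
        P.SolvesWithin gd (P.params ⌈P.innerIterations 4 2⌉₊) ε
          (C * max (√P.kappaX * P.kappaXY) (P.kappaXY ^ 2) * Real.log (1 / ε))
          (C * max (P.kappaX * P.kappaXY) (√P.kappaX * P.kappaXY ^ 2) * Real.log (1 / ε)) ∧
        P.SolvesWithin (halfHalf fgd gd) (P.params ⌈P.innerIterations 64 3⌉₊) ε
          (C * max (√P.kappaX * P.kappaXY) (P.kappaXY ^ 2) * Real.log (1 / ε))
          (C * max (P.kappaX ^ (5 / 6 : ℝ) * P.kappaXY)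
            (P.kappaX ^ (1 / 3 : ℝ) * P.kappaXY ^ 2) * Real.log (1 / ε)) ∧
        P.SolvesWithin (halfHalf fgd fsfom) (P.params ⌈P.innerIterations 256 4⌉₊) ε
          (C * max (√P.kappaX * P.kappaXY) (P.kappaXY ^ 2) * Real.log (1 / ε))
          (C * max (P.kappaX ^ (3 / 4 : ℝ) * P.kappaXY)
            (P.kappaX ^ (1 / 4 : ℝ) * P.kappaXY ^ 2) * Real.log (1 / ε))) := by
  -- `528 = 4 · 132`, where `4` bounds `A^(1/α)` for the three concrete pairs `(4, 2)`, `(64, 3)`,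
  -- `(256, 4)`.
  refine ⟨528, by norm_num, fun dx dy P hP => ⟨hP.existsUnique_reachable,
    fun M p hx hy x₀ y₀ => hP.exists_isRun M p hx hy x₀ y₀, ?_, ?_⟩⟩
  · intro A α hA hα M hM
    refine ⟨fun T hT => ⟨hP.one_div_one_sub_theta.1, hP.one_div_one_sub_theta.2.1,
      fun x₀ y₀ R hR xs ys hs k => ⟨hP.lyapunov_succ_le hA hα hM hT hR hs k,
        hP.le_lyapunov hA hα hM hT hR xs ys k, ?_, hP.lyapunov_le_pow hA hα hM hT hR hs k⟩⟩, ?_⟩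
    · refine (hP.le_lyapunov hA hα hM hT hR xs ys (k + 1)).trans
        ((hP.lyapunov_succ_le hA hα hM hT hR hs k).trans ?_)
      exact mul_le_of_le_one_left (hP.lyapunov_nonneg hA hα hM hT hR xs ys k)
        hP.one_div_one_sub_theta.2.1.le
    · intro ε hε hε2
      have hl : 0 ≤ Real.log (1 / ε) := Real.log_nonneg (by rw [le_div_iff₀ hε]; linarith)
      have hκ : 0 < P.kappaX := div_pos hP.LX_pos hP.muX_pos
      have hm : 0 ≤ max (√P.kappaX * P.kappaXY) (P.kappaXY ^ 2) :=
        le_max_of_le_right (sq_nonneg _)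
      have hm' : 0 ≤ max (P.kappaX ^ ((2 + α) / (2 * α)) * P.kappaXY)
          (P.kappaX ^ (1 / α) * P.kappaXY ^ 2) := le_max_of_le_right (by positivity)
      refine (hP.solvesWithin hA hα hM hε hε2).mono ?_ ?_ <;> gcongr <;> norm_num
  · intro ε hε hε2
    refine ⟨?_, ?_, ?_⟩
    · have h := hP.solvesWithin_of_rpow_le (β := 1) (γ := 1 / 2) (by norm_num) le_rfl
        (by norm_num) (by norm_num) (by norm_num) gd_hasGradientRate hε hε2
      rwa [Real.rpow_one, ← Real.sqrt_eq_rpow] at h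
    · exact hP.solvesWithin_of_rpow_le (by norm_num) (by norm_num) (by norm_num) (by norm_num)
        (by norm_num) halfHalf_fgd_gd_hasGradientRate hε hε2
    · exact hP.solvesWithin_of_rpow_le (by norm_num) (by norm_num) (by norm_num) (by norm_num)
        (by norm_num) halfHalf_fgd_fsfom_hasGradientRate hε hε2
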